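/- Let $A$ and $B$ be $C^*$-algebras and let $\epsilon>0$. Let $E$ be a $C^*$-$(A,B)$-bimodule, that is, a right Hilbert $C^*$-module over $B$ with a $*$-homomorphism from $A$ to the $C^*$-algebra $\mathrm{End}^*_B(E)$ of adjointable operators, and let $D$ be a selfadjoint regular operator on $E$. Write $\mathbb K(E)$ for the $B$-compact operators. The pair $(E,D)$ is an odd $\epsilon$-$KK$-cycle if 1. $a(1+D^2)^{-1/2}\in\mathbb K(E)$ for all $a\in A$; 2. the set $\mathrm{Lip}^\epsilon(E,D)$ of those $a\in A$ such that $a\,\mathrm{Dom}\,D\subseteq\mathrm{Dom}\,D$ and both $[D,a](1+D^2)^{-\frac{1-\epsilon}{2}}$ and $(1+D^2)^{-\frac{1-\epsilon}{2}}[D,a]$ (on their natural domains) extend to elements of $\mathrm{End}^*_B(E)$ is dense in $A$. It is an even $\epsilon$-$KK$-cycle if in addition $A$ and $B$ are $\mathbb Z/2$-graded (possibly trivially), $E$ is a $\mathbb Z/2$-graded $C^*$-$(A,B)$-bimodule, $D$ anticommutes with the grading operator of $E$, and commutators are understood as graded commutators. Theorem. Let $(E,D)$ be an odd (respectively even) $\epsilon$-$KK$-cycle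 for $(A,B)$. Then its bounded transform $F:=D(1+D^2)^{-1/2}$ is a well-defined element of $\mathrm{End}^*_B(E)$ and $(E,F)$ is an odd (respectively even) $(A,B)$-Kasparov module: for all $a\in A$ the operators $a(F^2-1)$, $a(F-F^*)$ and $[F,a]$ lie in $\mathbb K(E)$ (and, in the even case, $F$ is odd and $[F,a]$ is the graded commutator). Hence $(E,F)$ defines a class in $KK_1(A,B)$ (respectively $KK_0(A,B)$), the homotopy classes of odd (respectively even) $(A,B)$-Kasparov modules. -/

import Mathlib

universe u v w

noncomputable section

namespace EpsKK

open Filter Topology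

/-! ## Adjointable operators

Mathlib's Hilbert C⋆-modules `CStarModule C E` write the action of the coefficient algebra `C` on
the left, with `⟪x, c • y⟫ = c * ⟪x, y⟫`. A right Hilbert `B`-module is therefore the same thing as
a Hilbert module over `C = Bᵐᵒᵖ` in Mathlib's sense: `x b = op b • x` and
`⟪x, y b⟫ = ⟪x, y⟫ b` after applying `unop`. All operator-theoretic notions are defined for a
general `C` and are used with `C = Bᵐᵒᵖ`. -/

section Adjointable

variable (C E : Type*) [NonUnitalCStarAlgebra C] [PartialOrder C]
  [NormedAddCommGroup E] [NormedSpace ℂ E] [SMul C E] [CStarModule C E]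

variable {C E} in
theorem ext_inner {x y : E} (h : ∀ z : E, inner C z x = inner C z y) : x = y := by
  have h1 : inner C (x - y) (x - y) = 0 := by
    rw [CStarModule.inner_sub_right, h (x - y), sub_self]
  exact sub_eq_zero.mp (CStarModule.inner_self.mp h1)

/-- The adjointable operators on `E`, as a subalgebra of the bounded operators. -/
def adjSubalgebra : Subalgebra ℂ (E →L[ℂ] E) where
  carrier := {T | ∃ S : E →L[ℂ] E, ∀ x y : E, inner C (T x) y = inner C x (S y)}
  mul_mem' := by
    rintro T T' ⟨S, hS⟩ ⟨S', hS'⟩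
    exact ⟨S' * S, fun x y => by simp [hS, hS']⟩
  add_mem' := by
    rintro T T' ⟨S, hS⟩ ⟨S', hS'⟩
    exact ⟨S + S', fun x y => by simp [hS, hS']⟩
  algebraMap_mem' := by
    intro r
    refine ⟨algebraMap ℂ _ (star r), fun x y => ?_⟩
    simp [Algebra.algebraMap_eq_smul_one]

/-- The C⋆-algebra `End*_C(E)` of adjointable operators of a Hilbert `C`-module `E`
(an adjointable operator is automatically `C`-linear), with the operator norm. -/
def Adj : Type _ := adjSubalgebra C E

namespace Adj

instance : NormedRing (Adj C E) := inferInstanceAs (NormedRing (adjSubalgebra C E))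

instance : NormedAlgebra ℂ (Adj C E) := inferInstanceAs (NormedAlgebra ℂ (adjSubalgebra C E))

variable {C E}

/-- The bounded operator underlying an adjointable operator. -/
def toCLM (T : Adj C E) : E →L[ℂ] E := Subtype.val T

theorem toCLM_injective : Function.Injective (toCLM : Adj C E → E →L[ℂ] E) :=
  Subtype.val_injective

instance : FunLike (Adj C E) E E where
  coe T := T.toCLM
  coe_injective _ _ h := toCLM_injective (DFunLike.coe_injective h)

instance : ContinuousLinearMapClass (Adj C E) ℂ E E where
  map_add T := T.toCLM.map_add
  map_smulₛₗ T := T.toCLM.map_smul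
  map_continuous T := T.toCLM.continuous

@[ext] theorem ext {S T : Adj C E} (h : ∀ x, S x = T x) : S = T := DFunLike.ext _ _ h

@[simp] theorem toCLM_apply (T : Adj C E) (x : E) : T.toCLM x = T x := rfl
@[simp] theorem add_apply (S T : Adj C E) (x : E) : (S + T) x = S x + T x := rfl
@[simp] theorem sub_apply (S T : Adj C E) (x : E) : (S - T) x = S x - T x := rfl
@[simp] theorem neg_apply (T : Adj C E) (x : E) : (-T) x = -T x := rfl
@[simp] theorem zero_apply (x : E) : (0 : Adj C E) x = 0 := rfl
@[simp] theorem one_apply (x : E) : (1 : Adj C E) x = x := rfl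
@[simp] theorem mul_apply (S T : Adj C E) (x : E) : (S * T) x = S (T x) := rfl
@[simp] theorem smul_apply (r : ℂ) (T : Adj C E) (x : E) : (r • T) x = r • T x := rfl

theorem norm_def (T : Adj C E) : ‖T‖ = ‖T.toCLM‖ := rfl

theorem le_norm (T : Adj C E) (x : E) : ‖T x‖ ≤ ‖T‖ * ‖x‖ := T.toCLM.le_opNorm x

/-- A bounded operator with an adjoint, as an element of `End*_C(E)`. -/
def mk (T S : E →L[ℂ] E) (h : ∀ x y : E, inner C (T x) y = inner C x (S y)) : Adj C E :=
  ⟨T, S, h⟩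

@[simp] theorem mk_apply (T S : E →L[ℂ] E)
    (h : ∀ x y : E, inner C (T x) y = inner C x (S y)) (x : E) : mk T S h x = T x := rfl

theorem exists_adjoint (T : Adj C E) :
    ∃ S : E →L[ℂ] E, ∀ x y : E, inner C (T x) y = inner C x (S y) := Subtype.property T

/-- The adjoint of an adjointable operator. -/
instance : Star (Adj C E) where
  star T := mk T.exists_adjoint.choose T.toCLM fun x y => by
    rw [← CStarModule.star_inner, ← T.exists_adjoint.choose_spec y x]
    exact CStarModule.star_inner _ _

theorem inner_left (T : Adj C E) (x y : E) : inner C (T x) y = inner C x (star T y) :=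
  T.exists_adjoint.choose_spec x y

theorem inner_star_left (T : Adj C E) (x y : E) : inner C (star T x) y = inner C x (T y) := by
  rw [← CStarModule.star_inner, ← inner_left, CStarModule.star_inner]

theorem star_eq_of_inner {S T : Adj C E} (h : ∀ x y, inner C (T x) y = inner C x (S y)) :
    star T = S :=
  ext fun y => ext_inner (C := C) fun x => by rw [← inner_left, h]

instance : StarRing (Adj C E) where
  star_involutive T := star_eq_of_inner fun x y => inner_star_left T x y
  star_mul S T := star_eq_of_inner fun x y => by simp [inner_left]
  star_add S T := star_eq_of_inner fun x y => by simp [inner_left]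

instance : StarModule ℂ (Adj C E) where
  star_smul r T := star_eq_of_inner fun x y => by simp [inner_left]

section CStar

variable [StarOrderedRing C]

theorem norm_sq_apply_le (T : Adj C E) (x : E) :
    ‖T x‖ ^ 2 ≤ ‖star T * T‖ * ‖x‖ ^ 2 := by
  rw [CStarModule.norm_sq_eq C, inner_left]
  calc ‖inner C x (star T (T x))‖
      ≤ ‖x‖ * ‖star T (T x)‖ := CStarModule.norm_inner_le E
    _ ≤ ‖x‖ * (‖star T * T‖ * ‖x‖) := by
        gcongr
        exact (star T * T).le_norm x
    _ = ‖star T * T‖ * ‖x‖ ^ 2 := by ring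

theorem norm_mul_self_le_star (T : Adj C E) : ‖T‖ * ‖T‖ ≤ ‖star T * T‖ := by
  have h : ‖T‖ ≤ √‖star T * T‖ := by
    refine ContinuousLinearMap.opNorm_le_bound _ (Real.sqrt_nonneg _) fun x => ?_
    calc ‖T x‖ = √(‖T x‖ ^ 2) := (Real.sqrt_sq (norm_nonneg _)).symm
      _ ≤ √(‖star T * T‖ * ‖x‖ ^ 2) := Real.sqrt_le_sqrt (norm_sq_apply_le T x)
      _ = √‖star T * T‖ * ‖x‖ := by
        rw [Real.sqrt_mul (norm_nonneg _), Real.sqrt_sq (norm_nonneg _)]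
  calc ‖T‖ * ‖T‖ ≤ √‖star T * T‖ * √‖star T * T‖ := by gcongr
    _ = ‖star T * T‖ := Real.mul_self_sqrt (norm_nonneg _)

instance : CStarRing (Adj C E) := ⟨fun {T} => norm_mul_self_le_star T⟩

variable [CompleteSpace E]

variable (C E) in
theorem isClosed_adjSubalgebra :
    IsClosed ((adjSubalgebra C E : Subalgebra ℂ (E →L[ℂ] E)) : Set (E →L[ℂ] E)) := by
  refine isClosed_of_closure_subset fun T hT => ?_
  obtain ⟨u, hu, hlim⟩ := mem_closure_iff_seq_limit.mp hT
  let U : ℕ → Adj C E := fun n => ⟨u n, hu n⟩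
  have hc : CauchySeq fun n => (star (U n)).toCLM := by
    rw [Metric.cauchySeq_iff']
    intro ε hε
    obtain ⟨N, hN⟩ := Metric.cauchySeq_iff'.mp hlim.cauchySeq ε hε
    refine ⟨N, fun n hn => ?_⟩
    have h1 := hN n hn
    rw [dist_eq_norm] at h1 ⊢
    have h2 : ‖star (U n) - star (U N)‖ = ‖U n - U N‖ := by rw [← star_sub, norm_star]
    have h3 : ‖(star (U n)).toCLM - (star (U N)).toCLM‖ = ‖star (U n) - star (U N)‖ := rfl
    rw [h3, h2]
    exact h1
  obtain ⟨S, hS⟩ := cauchySeq_tendsto_of_complete hc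
  refine ⟨S, fun x y => ?_⟩
  have l1 : Tendsto (fun n => inner C (u n x) y) atTop (𝓝 (inner C (T x) y)) := by
    have hT : Tendsto (fun n => u n x) atTop (𝓝 (T x)) :=
      ((ContinuousLinearMap.apply ℂ E x).continuous.tendsto T).comp hlim
    exact ((CStarModule.continuous_inner (A := C)).tendsto (T x, y)).comp
      (hT.prodMk_nhds tendsto_const_nhds)
  have l2 : Tendsto (fun n => inner C x (star (U n) y)) atTop (𝓝 (inner C x (S y))) := by
    have hT : Tendsto (fun n => (star (U n)).toCLM y) atTop (𝓝 (S y)) :=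
      ((ContinuousLinearMap.apply ℂ E y).continuous.tendsto S).comp hS
    exact ((CStarModule.continuous_inner (A := C)).tendsto (x, S y)).comp
      (tendsto_const_nhds.prodMk_nhds hT)
  refine tendsto_nhds_unique l1 (l2.congr fun n => ?_)
  exact (inner_left (U n) x y).symm

instance : CompleteSpace (Adj C E) := (isClosed_adjSubalgebra C E).completeSpace_coe

instance : CStarAlgebra (Adj C E) where

end CStar

end Adj

variable {C E}

variable (C) in
/-- `C`-compact operators: norm limits of finite sums of the rank one operators
`z ↦ x ⟪y, z⟫`. -/
def IsCompactOp (T : E →L[ℂ] E) : Prop :=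
  ∀ η : ℝ, 0 < η → ∃ (n : ℕ) (x y : Fin n → E),
    ∀ z : E, ‖T z - ∑ i, (inner C (y i) z : C) • x i‖ ≤ η * ‖z‖

end Adjointable

/-! ## Selfadjoint regular operators -/

section Regular

variable (C E : Type*) [NonUnitalCStarAlgebra C] [PartialOrder C]
  [NormedAddCommGroup E] [NormedSpace ℂ E] [SMul C E] [CStarModule C E]

/-- A selfadjoint regular operator on a Hilbert `C`-module: a densely defined `C`-linear operator
`D` with `D = D*` and such that `1 + D² = 1 + D*D` has dense range. -/
structure RegularSelfAdjoint where
  /-- the underlying partially defined operator -/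
  op : E →ₗ.[ℂ] E
  dense_domain : Dense (op.domain : Set E)
  smul_mem : ∀ (c : C) (x : op.domain), c • (x : E) ∈ op.domain
  map_smul : ∀ (c : C) (x : op.domain), op ⟨c • (x : E), smul_mem c x⟩ = c • op x
  /-- `(y, z)` is in the graph of `D*` if and only if it is in the graph of `D`. -/
  selfAdjoint : ∀ y z : E,
    (∀ x : op.domain, inner C (op x) y = inner C (x : E) z) ↔
      ∃ hy : y ∈ op.domain, op ⟨y, hy⟩ = z
  dense_range : Dense {z : E | ∃ (x : op.domain) (hx : op x ∈ op.domain),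
    (x : E) + op ⟨op x, hx⟩ = z}

variable {C E}

namespace RegularSelfAdjoint

variable (D : RegularSelfAdjoint C E)

theorem inner_symm (x y : D.op.domain) : inner C (D.op x) (y : E) = inner C (x : E) (D.op y) :=
  (D.selfAdjoint y (D.op y)).mpr ⟨y.2, rfl⟩ x

variable [StarOrderedRing C]

theorem norm_bounds (x : D.op.domain) (hx : D.op x ∈ D.op.domain) :
    ‖(x : E)‖ ≤ ‖(x : E) + D.op ⟨D.op x, hx⟩‖ ∧ ‖D.op x‖ ≤ ‖(x : E) + D.op ⟨D.op x, hx⟩‖ := by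
  set w := (x : E) + D.op ⟨D.op x, hx⟩ with hw
  have key : inner C (x : E) w = inner C (x : E) (x : E) + inner C (D.op x) (D.op x) := by
    rw [hw, CStarModule.inner_add_right, ← D.inner_symm]
  have n1 : (0 : C) ≤ inner C (x : E) (x : E) := CStarModule.inner_self_nonneg
  have n2 : (0 : C) ≤ inner C (D.op x) (D.op x) := CStarModule.inner_self_nonneg
  have b : ‖inner C (x : E) w‖ ≤ ‖(x : E)‖ * ‖w‖ := CStarModule.norm_inner_le E
  have b1 : ‖(x : E)‖ ^ 2 ≤ ‖(x : E)‖ * ‖w‖ := by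
    refine le_trans ?_ b
    rw [CStarModule.norm_sq_eq C, key]
    exact CStarAlgebra.norm_le_norm_of_nonneg_of_le n1 (le_add_of_nonneg_right n2)
  have b2 : ‖D.op x‖ ^ 2 ≤ ‖(x : E)‖ * ‖w‖ := by
    refine le_trans ?_ b
    rw [CStarModule.norm_sq_eq C, key]
    exact CStarAlgebra.norm_le_norm_of_nonneg_of_le n2 (le_add_of_nonneg_left n1)
  have c1 : ‖(x : E)‖ ≤ ‖w‖ := by
    by_contra! h
    nlinarith [norm_nonneg w, norm_nonneg (x : E)]
  refine ⟨c1, ?_⟩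
  refine abs_le_of_sq_le_sq' ?_ (norm_nonneg w) |>.2
  nlinarith [norm_nonneg w]

theorem closed_graph {u v : ℕ → E} {x y : E} (hu : ∀ n, ∃ h : u n ∈ D.op.domain, D.op ⟨u n, h⟩ = v n)
    (hx : Tendsto u atTop (𝓝 x)) (hy : Tendsto v atTop (𝓝 y)) :
    ∃ h : x ∈ D.op.domain, D.op ⟨x, h⟩ = y := by
  rw [← D.selfAdjoint]
  intro w
  have l1 : Tendsto (fun n => inner C (D.op w) (u n)) atTop (𝓝 (inner C (D.op w) x)) :=
    ((CStarModule.continuous_inner (A := C)).tendsto (D.op w, x)).comp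
      (tendsto_const_nhds.prodMk_nhds hx)
  have l2 : Tendsto (fun n => inner C (w : E) (v n)) atTop (𝓝 (inner C (w : E) y)) :=
    ((CStarModule.continuous_inner (A := C)).tendsto ((w : E), y)).comp
      (tendsto_const_nhds.prodMk_nhds hy)
  refine tendsto_nhds_unique l1 (l2.congr fun n => ?_)
  obtain ⟨h, hn⟩ := hu n
  rw [← hn, ← D.inner_symm w ⟨u n, h⟩]

theorem resolvent_unique {x y : D.op.domain} {hx : D.op x ∈ D.op.domain}
    {hy : D.op y ∈ D.op.domain}
    (h : (x : E) + D.op ⟨D.op x, hx⟩ = (y : E) + D.op ⟨D.op y, hy⟩) : (x : E) = y := by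
  have hm : D.op (x - y) ∈ D.op.domain := by
    rw [LinearPMap.map_sub]; exact D.op.domain.sub_mem hx hy
  have e : (⟨D.op (x - y), hm⟩ : D.op.domain) = ⟨D.op x, hx⟩ - ⟨D.op y, hy⟩ :=
    Subtype.ext (LinearPMap.map_sub _ _ _)
  have := (D.norm_bounds (x - y) hm).1
  rw [e, LinearPMap.map_sub] at this
  have e2 : ((x - y : D.op.domain) : E) + (D.op ⟨D.op x, hx⟩ - D.op ⟨D.op y, hy⟩) = 0 := by
    rw [Submodule.coe_sub, ← sub_eq_zero.mpr h]; abel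
  rw [e2, norm_zero, norm_le_zero_iff, Submodule.coe_sub, sub_eq_zero] at this
  exact this

variable [CompleteSpace E]

theorem exists_resolvent (z : E) : ∃ (x : D.op.domain) (hx : D.op x ∈ D.op.domain),
    (x : E) + D.op ⟨D.op x, hx⟩ = z := by
  obtain ⟨s, hs, hlim⟩ := mem_closure_iff_seq_limit.mp (D.dense_range z)
  choose x hx hs using hs
  have hdiff : ∀ n m, ‖(x n : E) - x m‖ ≤ ‖s n - s m‖ ∧ ‖D.op (x n) - D.op (x m)‖ ≤ ‖s n - s m‖ := by
    intro n m
    have hm : D.op (x n - x m) ∈ D.op.domain := by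
      rw [LinearPMap.map_sub]; exact D.op.domain.sub_mem (hx n) (hx m)
    have e : (⟨D.op (x n - x m), hm⟩ : D.op.domain) = ⟨D.op (x n), hx n⟩ - ⟨D.op (x m), hx m⟩ :=
      Subtype.ext (LinearPMap.map_sub _ _ _)
    have := D.norm_bounds (x n - x m) hm
    rw [e, LinearPMap.map_sub, LinearPMap.map_sub] at this
    have e2 : ((x n - x m : D.op.domain) : E)
        + (D.op ⟨D.op (x n), hx n⟩ - D.op ⟨D.op (x m), hx m⟩) = s n - s m := by
      rw [← hs n, ← hs m, Submodule.coe_sub]; abel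
    rw [e2] at this
    exact this
  have hcs := hlim.cauchySeq
  have cauchy : ∀ f : ℕ → E, (∀ n m, ‖f n - f m‖ ≤ ‖s n - s m‖) → CauchySeq f := by
    intro f hf
    rw [Metric.cauchySeq_iff'] at hcs ⊢
    intro ε hε
    obtain ⟨N, hN⟩ := hcs ε hε
    refine ⟨N, fun n hn => ?_⟩
    have := hN n hn
    rw [dist_eq_norm] at this ⊢
    exact (hf n N).trans_lt this
  obtain ⟨a, ha⟩ := cauchySeq_tendsto_of_complete (cauchy (fun n => (x n : E)) fun n m => (hdiff n m).1)
  obtain ⟨b, hb⟩ := cauchySeq_tendsto_of_complete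
    (cauchy (fun n => D.op (x n)) fun n m => (hdiff n m).2)
  have hc : Tendsto (fun n => D.op ⟨D.op (x n), hx n⟩) atTop (𝓝 (z - a)) := by
    refine (hlim.sub ha).congr fun n => ?_
    rw [← hs n]; abel
  obtain ⟨h1, e1⟩ := D.closed_graph (fun n => ⟨(x n).2, rfl⟩) ha hb
  obtain ⟨h2, e2⟩ := D.closed_graph (fun n => ⟨hx n, rfl⟩) hb hc
  subst e1
  exact ⟨⟨a, h1⟩, h2, by rw [e2]; abel⟩

/-- The bounded operator `(1 + D²)⁻¹`, as a function. -/
def resolventFun (z : E) : E := (D.exists_resolvent z).choose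

theorem resolventFun_spec (z : E) : ∃ (h1 : D.resolventFun z ∈ D.op.domain)
    (h2 : D.op ⟨D.resolventFun z, h1⟩ ∈ D.op.domain),
    D.resolventFun z + D.op ⟨D.op ⟨D.resolventFun z, h1⟩, h2⟩ = z :=
  ⟨(D.exists_resolvent z).choose.2, (D.exists_resolvent z).choose_spec⟩

theorem resolventFun_eq {z : E} {x : D.op.domain} {hx : D.op x ∈ D.op.domain}
    (h : (x : E) + D.op ⟨D.op x, hx⟩ = z) : D.resolventFun z = x := by
  obtain ⟨h1, h2, h3⟩ := D.resolventFun_spec z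
  exact D.resolvent_unique (x := ⟨_, h1⟩) (hx := h2) (h3.trans h.symm)

/-- `(1 + D²)⁻¹` as a continuous linear map. -/
def resolventCLM : E →L[ℂ] E :=
  LinearMap.mkContinuous
    { toFun := D.resolventFun
      map_add' := by
        intro z w
        obtain ⟨a1, a2, a3⟩ := D.resolventFun_spec z
        obtain ⟨b1, b2, b3⟩ := D.resolventFun_spec w
        have e0 := LinearPMap.map_add D.op ⟨_, a1⟩ ⟨_, b1⟩
        have hm : D.op (⟨_, a1⟩ + ⟨_, b1⟩) ∈ D.op.domain := by
          rw [e0]; exact D.op.domain.add_mem a2 b2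
        have e : (⟨_, hm⟩ : D.op.domain) = ⟨_, a2⟩ + ⟨_, b2⟩ := Subtype.ext e0
        refine D.resolventFun_eq (x := ⟨_, a1⟩ + ⟨_, b1⟩) (hx := hm) ?_
        rw [e, LinearPMap.map_add]
        conv_rhs => rw [← a3, ← b3]
        rw [Submodule.coe_add]; abel
      map_smul' := by
        intro r z
        obtain ⟨a1, a2, a3⟩ := D.resolventFun_spec z
        have e0 := LinearPMap.map_smul D.op r ⟨_, a1⟩
        have hm : D.op (r • ⟨_, a1⟩) ∈ D.op.domain := by
          rw [e0]; exact D.op.domain.smul_mem r a2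
        have e : (⟨_, hm⟩ : D.op.domain) = r • ⟨_, a2⟩ := Subtype.ext e0
        refine D.resolventFun_eq (x := r • ⟨_, a1⟩) (hx := hm) ?_
        rw [e, LinearPMap.map_smul]
        conv_rhs => rw [← a3]
        rw [Submodule.coe_smul, smul_add] }
    1 fun z => by
      obtain ⟨a1, a2, a3⟩ := D.resolventFun_spec z
      have := (D.norm_bounds ⟨_, a1⟩ a2).1
      rw [a3] at this
      simpa using this

theorem inner_resolventCLM (z w : E) :
    inner C (D.resolventCLM z) w = inner C z (D.resolventCLM w) := by
  change inner C (D.resolventFun z) w = inner C z (D.resolventFun w)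
  obtain ⟨a1, a2, a3⟩ := D.resolventFun_spec z
  obtain ⟨b1, b2, b3⟩ := D.resolventFun_spec w
  conv_lhs => rw [← b3]
  conv_rhs => rw [← a3]
  rw [CStarModule.inner_add_right, CStarModule.inner_add_left]
  congr 1
  rw [← D.inner_symm ⟨_, a1⟩ ⟨_, b2⟩, D.inner_symm ⟨_, a2⟩ ⟨_, b1⟩]

/-- The adjointable operator `(1 + D²)⁻¹`. -/
def resolvent : Adj C E := Adj.mk D.resolventCLM D.resolventCLM D.inner_resolventCLM

/-- `resolvent` is the inverse of `1 + D²`. -/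
theorem resolvent_spec (z : E) : ∃ (h1 : D.resolvent z ∈ D.op.domain)
    (h2 : D.op ⟨D.resolvent z, h1⟩ ∈ D.op.domain),
    D.resolvent z + D.op ⟨D.op ⟨D.resolvent z, h1⟩, h2⟩ = z :=
  D.resolventFun_spec z

theorem isSelfAdjoint_resolvent : IsSelfAdjoint D.resolvent :=
  Adj.star_eq_of_inner D.inner_resolventCLM

/-- The bounded operator `(1 + D²)^(-s)` for `s ≥ 0`, by continuous functional calculus in
`End*_C(E)`. -/
def bddPow (s : ℝ) : Adj C E := cfc (fun t : ℝ => t ^ s) D.resolvent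

/-- The graph of `(1 + D²)^r` for an arbitrary real `r`: `y = (1 + D²)^r x`. For `r ≤ 0` it is the
graph of a bounded operator, for `r > 0` that of the (in general unbounded) inverse of
`(1 + D²)^(-r)`. -/
def PowGraph (r : ℝ) (x y : E) : Prop :=
  if r ≤ 0 then D.bddPow (-r) x = y else D.bddPow r y = x

/-- `F = D (1 + D²)^(-1/2)`, the bounded transform of `D`. -/
def IsBoundedTransform (F : Adj C E) : Prop :=
  ∀ x : E, ∃ hx : D.bddPow (1 / 2) x ∈ D.op.domain, D.op ⟨D.bddPow (1 / 2) x, hx⟩ = F x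

/-- `a` and `a'` are adjointable operators such that `a` preserves the domain of `D` and both
`[D, a] (1 + D²)^(-(1-ε)/2)` and `(1 + D²)^(-(1-ε)/2) [D, a]`, defined on their natural domains,
extend to adjointable operators, where `[D, a] = D a - a' D`. For the ordinary commutator take
`a' = a`; for the graded commutator `a'` is the image of `a` under the grading automorphism. -/
structure IsEpsBounded (ε : ℝ) (a a' : Adj C E) : Prop where
  mem_domain : ∀ x : D.op.domain, a x ∈ D.op.domain
  comm_pow : ∃ T : Adj C E, ∀ (x : E) (y : D.op.domain), D.PowGraph (-((1 - ε) / 2)) x y →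
    T x = D.op ⟨a y, mem_domain y⟩ - a' (D.op y)
  pow_comm : ∃ T : Adj C E, ∀ (x : D.op.domain) (y : E),
    D.PowGraph (-((1 - ε) / 2)) (D.op ⟨a x, mem_domain x⟩ - a' (D.op x)) y → T x = y

end RegularSelfAdjoint

end Regular

/-! ## Gradings -/

section Grading

/-- A `ℤ/2`-grading of a C⋆-algebra, given by its grading automorphism: a `*`-homomorphism of
square one. -/
structure Grading (C : Type*) [NonUnitalCStarAlgebra C] where
  /-- the grading automorphism, `c ↦ (-1)^|c| c` on homogeneous elements -/
  hom : C →⋆ₙₐ[ℂ] C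
  hom_hom : ∀ c, hom (hom c) = c

namespace Grading

variable {C : Type*} [NonUnitalCStarAlgebra C]

/-- The trivial grading. -/
def trivial (C : Type*) [NonUnitalCStarAlgebra C] : Grading C where
  hom := NonUnitalStarAlgHom.id ℂ C
  hom_hom _ := rfl

/-- The same grading on the opposite algebra. -/
def op (β : Grading C) : Grading Cᵐᵒᵖ where
  hom :=
    { toFun := fun c => .op (β.hom c.unop)
      map_smul' := fun r c => by simp
      map_zero' := by simp
      map_add' := fun c d => by simp
      map_mul' := fun c d => by simp
      map_star' := fun c => by simp [map_star] }
  hom_hom c := by simp [β.hom_hom]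

/-- The pointwise grading on the C⋆-algebra `C([0,1], C)`. -/
def path (β : Grading C) : Grading C(unitInterval, C) where
  hom :=
    { toFun := fun f => ⟨fun t => β.hom (f t), ((AddMonoidHomClass.continuous_of_bound β.hom 1 fun c => by
        simpa using NonUnitalStarAlgHom.norm_apply_le β.hom c)).comp f.continuous⟩
      map_smul' := fun r f => by ext; simp
      map_zero' := by ext; simp
      map_add' := fun f g => by ext; simp
      map_mul' := fun f g => by ext; simp
      map_star' := fun f => by ext; simp [map_star] }
  hom_hom f := by ext; simp [β.hom_hom]

end Grading

/-- A grading operator on a Hilbert module over the graded C⋆-algebra `(C, β)`. -/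
structure ModuleGrading {C : Type*} [NonUnitalCStarAlgebra C] [PartialOrder C] (β : Grading C)
    (E : Type*) [NormedAddCommGroup E] [NormedSpace ℂ E] [SMul C E] [CStarModule C E] where
  /-- the grading operator -/
  hom : E →ₗ[ℂ] E
  hom_hom : ∀ x, hom (hom x) = x
  hom_smul : ∀ (c : C) (x : E), hom (c • x) = β.hom c • hom x
  inner_hom : ∀ x y : E, (inner C (hom x) (hom y) : C) = β.hom (inner C x y)

end Grading

/-! ## Unbounded cycles and Kasparov modules -/

section Cycles

variable {A C E : Type*} [NonUnitalCStarAlgebra A] [NonUnitalCStarAlgebra C] [PartialOrder C]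
  [NormedAddCommGroup E] [NormedSpace ℂ E] [SMul C E] [CStarModule C E]

/-- The representation `π : A → End*_C(E)` makes `E` a graded bimodule: `γ(a x) = α(a) γ(x)`. -/
def IsGradedRep (α : Grading A) {β : Grading C} (γ : ModuleGrading β E) (π : A →⋆ₙₐ[ℂ] Adj C E) :
    Prop :=
  ∀ (a : A) (x : E), γ.hom (π a x) = π (α.hom a) (γ.hom x)

/-- The `C⋆`-bimodule `E` (with left action `π` and coefficients `C`) and the operator `F` form an
odd Kasparov module. -/
structure IsOddKasparov (π : A →⋆ₙₐ[ℂ] Adj C E) (F : Adj C E) : Prop where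
  sq_sub_one : ∀ a, IsCompactOp C (π a * (F * F - 1)).toCLM
  sub_star : ∀ a, IsCompactOp C (π a * (F - star F)).toCLM
  commutator : ∀ a, IsCompactOp C (F * π a - π a * F).toCLM

/-- The graded `C⋆`-bimodule `E` (with left action `π`, coefficients `C` and grading operator `γ`)
and the odd operator `F` form an even Kasparov module; the commutator is the graded one. -/
structure IsEvenKasparov (α : Grading A) {β : Grading C} (γ : ModuleGrading β E)
    (π : A →⋆ₙₐ[ℂ] Adj C E) (F : Adj C E) : Prop where
  graded : IsGradedRep α γ π
  odd : ∀ x : E, γ.hom (F x) = -F (γ.hom x)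
  sq_sub_one : ∀ a, IsCompactOp C (π a * (F * F - 1)).toCLM
  sub_star : ∀ a, IsCompactOp C (π a * (F - star F)).toCLM
  commutator : ∀ a, IsCompactOp C (F * π a - π (α.hom a) * F).toCLM

variable [StarOrderedRing C] [CompleteSpace E]

/-- `(E, D)` is an odd `ε`-`KK`-cycle. -/
structure IsOddEpsCycle (ε : ℝ) (π : A →⋆ₙₐ[ℂ] Adj C E) (D : RegularSelfAdjoint C E) : Prop where
  compact : ∀ a, IsCompactOp C (π a * D.bddPow (1 / 2)).toCLM
  /-- `Lip^ε(E, D)` is dense in `A`. -/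
  dense_lip : Dense {a : A | D.IsEpsBounded ε (π a) (π a)}

/-- `(E, D)` is an even `ε`-`KK`-cycle: `E` is a graded bimodule, `D` anticommutes with the grading
operator, and commutators are graded. -/
structure IsEvenEpsCycle (ε : ℝ) (α : Grading A) {β : Grading C} (γ : ModuleGrading β E)
    (π : A →⋆ₙₐ[ℂ] Adj C E) (D : RegularSelfAdjoint C E) : Prop where
  graded : IsGradedRep α γ π
  odd : ∀ x : D.op.domain, ∃ hx : γ.hom (x : E) ∈ D.op.domain,
    D.op ⟨γ.hom (x : E), hx⟩ = -γ.hom (D.op x)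
  compact : ∀ a, IsCompactOp C (π a * D.bddPow (1 / 2)).toCLM
  /-- `Lip^ε(E, D)` is dense in `A`. -/
  dense_lip : Dense {a : A | D.IsEpsBounded ε (π a) (π (α.hom a))}

end Cycles

/-! ## Homotopy classes of Kasparov modules -/

section KK

/-- Odd Kasparov modules, with coefficients `C`. -/
structure OddKasparovModule (A : Type u) (C : Type v) [NonUnitalCStarAlgebra A]
    [NonUnitalCStarAlgebra C] [PartialOrder C] where
  E : Type w
  [normedAddCommGroup : NormedAddCommGroup E]
  [normedSpace : NormedSpace ℂ E]
  [completeSpace : CompleteSpace E]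
  [smul : SMul C E]
  [cstarModule : CStarModule C E]
  π : A →⋆ₙₐ[ℂ] Adj C E
  F : Adj C E
  isOddKasparov : IsOddKasparov π F

/-- Even Kasparov modules over the graded C⋆-algebras `(A, α)` and `(C, β)`. -/
structure EvenKasparovModule {A : Type u} {C : Type v} [NonUnitalCStarAlgebra A]
    [NonUnitalCStarAlgebra C] [PartialOrder C] (α : Grading A) (β : Grading C) where
  E : Type w
  [normedAddCommGroup : NormedAddCommGroup E]
  [normedSpace : NormedSpace ℂ E]
  [completeSpace : CompleteSpace E]
  [smul : SMul C E]
  [cstarModule : CStarModule C E]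
  γ : ModuleGrading β E
  π : A →⋆ₙₐ[ℂ] Adj C E
  F : Adj C E
  isEvenKasparov : IsEvenKasparov α γ π F

attribute [instance] OddKasparovModule.normedAddCommGroup OddKasparovModule.normedSpace
  OddKasparovModule.completeSpace OddKasparovModule.smul OddKasparovModule.cstarModule
  EvenKasparovModule.normedAddCommGroup EvenKasparovModule.normedSpace
  EvenKasparovModule.completeSpace EvenKasparovModule.smul EvenKasparovModule.cstarModule

/-- `q` exhibits the Hilbert `C`-module `E` as the fibre at `t` (that is, as the interior tensor
product along the evaluation at `t`) of the Hilbert `C([0,1], C)`-module `H`, and intertwines the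
left actions and the operators. -/
structure IsFibreMap {A C H E : Type*} [NonUnitalCStarAlgebra A] [NonUnitalCStarAlgebra C]
    [PartialOrder C] [NormedAddCommGroup H] [NormedSpace ℂ H] [SMul C(unitInterval, C) H]
    [CStarModule C(unitInterval, C) H] [NormedAddCommGroup E] [NormedSpace ℂ E] [SMul C E]
    [CStarModule C E] (t : unitInterval) (ρ : A →⋆ₙₐ[ℂ] Adj C(unitInterval, C) H)
    (G : Adj C(unitInterval, C) H) (π : A →⋆ₙₐ[ℂ] Adj C E) (F : Adj C E) (q : H →ₗ[ℂ] E) :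
    Prop where
  surjective : Function.Surjective q
  map_smul : ∀ (f : C(unitInterval, C)) (x : H), q (f • x) = f t • q x
  map_inner : ∀ x y : H, (inner C (q x) (q y) : C) = (inner C(unitInterval, C) x y) t
  map_rep : ∀ (a : A) (x : H), q (ρ a x) = π a (q x)
  map_op : ∀ x : H, q (G x) = F (q x)

/-- Two odd Kasparov modules are homotopic if they are (unitarily equivalent to) the fibres at
`0` and `1` of an odd Kasparov module with coefficients `C([0,1], C)`. -/
def OddHomotopic {A : Type u} {C : Type v} [NonUnitalCStarAlgebra A] [NonUnitalCStarAlgebra C]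
    [PartialOrder C] (M N : OddKasparovModule.{u, v, w} A C) : Prop :=
  ∃ H : OddKasparovModule.{u, v, w} A C(unitInterval, C),
    (∃ q : H.E →ₗ[ℂ] M.E, IsFibreMap 0 H.π H.F M.π M.F q) ∧
    (∃ q : H.E →ₗ[ℂ] N.E, IsFibreMap 1 H.π H.F N.π N.F q)

/-- Homotopy of even Kasparov modules; the identifications of the fibres respect the gradings. -/
def EvenHomotopic {A : Type u} {C : Type v} [NonUnitalCStarAlgebra A] [NonUnitalCStarAlgebra C]
    [PartialOrder C] {α : Grading A} {β : Grading C} (M N : EvenKasparovModule.{u, v, w} α β) :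
    Prop :=
  ∃ H : EvenKasparovModule.{u, v, w} α β.path,
    (∃ q : H.E →ₗ[ℂ] M.E, IsFibreMap 0 H.π H.F M.π M.F q ∧
      ∀ x, q (H.γ.hom x) = M.γ.hom (q x)) ∧
    (∃ q : H.E →ₗ[ℂ] N.E, IsFibreMap 1 H.π H.F N.π N.F q ∧
      ∀ x, q (H.γ.hom x) = N.γ.hom (q x))

/-- `KK₁(A, B)`: homotopy classes of odd `(A, B)`-Kasparov modules. Their Hilbert modules are right
Hilbert `B`-modules, that is, modules over `Bᵐᵒᵖ`. -/
def KKOne (A : Type u) (B : Type v) [NonUnitalCStarAlgebra A] [NonUnitalCStarAlgebra B]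
    [PartialOrder B] : Type _ :=
  Quot (OddHomotopic.{u, v, w} (A := A) (C := Bᵐᵒᵖ))

/-- `KK₀(A, B)`: homotopy classes of even `(A, B)`-Kasparov modules, for graded C⋆-algebras
`(A, α)` and `(B, β)`. -/
def KKZero {A : Type u} {B : Type v} [NonUnitalCStarAlgebra A] [NonUnitalCStarAlgebra B]
    [PartialOrder B] (α : Grading A) (β : Grading B) : Type _ :=
  Quot (EvenHomotopic.{u, v, w} (α := α) (β := β.op))

/-- The class in `KK₁(A, B)` of an odd Kasparov module. -/
def KKOne.mk {A : Type u} {B : Type v} [NonUnitalCStarAlgebra A] [NonUnitalCStarAlgebra B]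
    [PartialOrder B] (M : OddKasparovModule.{u, v, w} A Bᵐᵒᵖ) : KKOne.{u, v, w} A B :=
  Quot.mk _ M

/-- The class in `KK₀(A, B)` of an even Kasparov module. -/
def KKZero.mk {A : Type u} {B : Type v} [NonUnitalCStarAlgebra A] [NonUnitalCStarAlgebra B]
    [PartialOrder B] {α : Grading A} {β : Grading B} (M : EvenKasparovModule.{u, v, w} α β.op) :
    KKZero.{u, v, w} α β :=
  Quot.mk _ M

end KK

end EpsKK

end

noncomputable section

namespace EpsKK

section Analysis

open Filter Topology MeasureTheory Set

/-! ## Integrability on the half-line -/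

section HalfLine

/-! Write `R = (1 + D²)⁻¹`, `H = R^(1/2)`, `F = D H` and `[D, a] = D a - a' D`, where `a'` is the
image of `a` under the grading (`a' = a` in the odd case). A Lipschitz `a` preserves `Dom D = Ran
H`, so `a H = H N` with `N` bounded, and the commutator condition becomes `[D, a] H = T R^s` with `s
= min ε 1 / 2` (`exists_of_isEpsBounded`). In these terms the unbounded operator disappears and the
core of the argument takes place in a C⋆-algebra.

The formula `H = c ∫ t^(-1/2) R (t + R)⁻¹ dt` suggests `F = c ∫ t^(-1/2) D S dt` with `S = R (t +
R)⁻¹ = (1 + t + t D²)⁻¹`. The available bound on this integrand is only `t⁻¹` near `0`, but its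
graded commutator with `a` is better: it equals `t^(-1/2)` times `(1 + t) S [D, a] S - t (D S) [D,
a'] (D S)`, and the factor `R^s` gained from the hypothesis makes this `O(t^(s-1))` at `0` and
`O(t^(-3/2))` at infinity (`commutator_mul_invAdd`, `mul_commutator_mem`). If `b H` is compact,
multiplying on the left by `b` makes every value of the integrand compact, hence also `b [F, a]`.

To remove `b`, `commutator_mem_compactOps` passes to all `a` by density, takes adjoints, and uses
the Leibniz rule together with the factorization of selfadjoint elements of `A` as products. The
other Kasparov conditions follow from `F² - 1 = -R` and `F = F*`. In the even case conjugation by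
the grading operator fixes `R` and negates `F`. -/

/-- The majorant `t ^ (s - 1)` near `0`, `t ^ (-3/2)` near infinity. -/
def halfLineBound (s t : ℝ) : ℝ := if t ≤ 1 then t ^ (s - 1) else t ^ (-(3 / 2) : ℝ)

theorem integrableOn_halfLineBound {s : ℝ} (hs : 0 < s) :
    IntegrableOn (halfLineBound s) (Ioi 0) := by
  rw [← Ioc_union_Ioi_eq_Ioi (zero_le_one (α := ℝ))]
  refine IntegrableOn.union ?_ ?_
  · have h : IntegrableOn (fun t : ℝ => t ^ (s - 1)) (Ioc 0 1) :=
      (intervalIntegrable_iff_integrableOn_Ioc_of_le zero_le_one).mp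
        (intervalIntegral.intervalIntegrable_rpow' (by linarith))
    exact h.congr_fun (fun t ht => by simp [halfLineBound, ht.2]) measurableSet_Ioc
  · have h : IntegrableOn (fun t : ℝ => t ^ (-(3 / 2) : ℝ)) (Ioi 1) :=
      integrableOn_Ioi_rpow_of_lt (by norm_num) one_pos
    exact h.congr_fun (fun t ht => by simp [halfLineBound, not_le.mpr (mem_Ioi.mp ht)])
      measurableSet_Ioi

/-- The quotient map by a closed subspace is continuous and linear, so it commutes with the integral
and sends it to zero. Without integrability the integral is `0` by convention. -/
theorem integral_mem_submodule {V : Type*} [NormedAddCommGroup V] [NormedSpace ℂ V]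
    [CompleteSpace V] {X : Type*} [MeasurableSpace X] {μ : Measure X} (K : Submodule ℂ V)
    (hK : IsClosed (K : Set V)) {f : X → V} (hf : ∀ᵐ t ∂μ, f t ∈ K) : ∫ t, f t ∂μ ∈ K := by
  by_cases hi : Integrable f μ
  · have : IsClosed (K : Set V) := hK
    rw [← Submodule.Quotient.mk_eq_zero]
    have h := ContinuousLinearMap.integral_comp_comm K.mkQL hi
    have h0 : ∫ t, K.mkQL (f t) ∂μ = 0 := by
      rw [integral_congr_ae (g := fun _ => 0), integral_zero]
      filter_upwards [hf] with t ht
      simpa using ht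
    rw [h0] at h
    exact h.symm
  · rw [integral_undef hi]; exact K.zero_mem

end HalfLine

/-! ## Commutator estimates in a C⋆-algebra -/

section Abstract

variable {𝒜 : Type*} [CStarAlgebra 𝒜] {R : 𝒜}

/-- The element `(t + R)⁻¹`. -/
def invAdd (R : 𝒜) (t : ℝ) : 𝒜 := cfc (fun x : ℝ => (t + x)⁻¹) R

/-- The element `R ^ s`. -/
def rpow (R : 𝒜) (s : ℝ) : 𝒜 := cfc (fun x : ℝ => x ^ s) R

theorem continuousOn_inv_add (h0 : ∀ x ∈ spectrum ℝ R, 0 ≤ x) {t : ℝ} (ht : 0 < t) :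
    ContinuousOn (fun x : ℝ => (t + x)⁻¹) (spectrum ℝ R) :=
  (continuousOn_const.add continuousOn_id).inv₀ fun x hx => by
    have := h0 x hx
    exact (add_pos_of_pos_of_nonneg ht this).ne'

theorem rpow_add (h0 : ∀ x ∈ spectrum ℝ R, 0 ≤ x) {s r : ℝ} (hs : 0 ≤ s) (hr : 0 ≤ r) :
    rpow R (s + r) = rpow R s * rpow R r := by
  rw [rpow, rpow, rpow, ← cfc_mul _ _ R (Real.continuous_rpow_const hs).continuousOn
    (Real.continuous_rpow_const hr).continuousOn]
  exact cfc_congr fun x hx => Real.rpow_add_of_nonneg (h0 x hx) hs hr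

theorem rpow_one (hR : IsSelfAdjoint R) : rpow R 1 = R := by
  simp only [rpow, Real.rpow_one]
  exact cfc_id' ℝ R

theorem isSelfAdjoint_rpow (s : ℝ) : IsSelfAdjoint (rpow R s) := cfc_predicate _ _

theorem invAdd_mul (hR : IsSelfAdjoint R) (h0 : ∀ x ∈ spectrum ℝ R, 0 ≤ x) {t : ℝ}
    (ht : 0 < t) : invAdd R t * ((t : ℂ) • 1 + R) = 1 := by
  have h1 : ((t : ℂ) • 1 + R : 𝒜) = cfc (fun x : ℝ => t + x) R := by
    rw [cfc_const_add t (fun x : ℝ => x) R, cfc_id' ℝ R, Algebra.algebraMap_eq_smul_one]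
    simp
  rw [h1, invAdd, ← cfc_mul _ _ R (continuousOn_inv_add h0 ht) (by fun_prop), ← cfc_one ℝ R]
  refine cfc_congr fun x hx => ?_
  have := h0 x hx
  exact inv_mul_cancel₀ (by positivity)

theorem smul_invAdd_add (hR : IsSelfAdjoint R) (h0 : ∀ x ∈ spectrum ℝ R, 0 ≤ x) {t : ℝ}
    (ht : 0 < t) : (t : ℂ) • invAdd R t + R * invAdd R t = 1 := by
  have hRQ : R * invAdd R t = invAdd R t * R := (Commute.refl R).cfc_real _ |>.eq.symm
  rw [hRQ, ← invAdd_mul hR h0 ht, mul_add, mul_smul_comm, mul_one]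

/-- On the half-line these are inverses of units depending continuously on `t`, and inversion is
continuous at units. This supplies the measurability of the operator-valued integrands. -/
theorem continuousOn_invAdd (hR : IsSelfAdjoint R) (h0 : ∀ x ∈ spectrum ℝ R, 0 ≤ x) :
    ContinuousOn (invAdd R) (Ioi 0) := by
  have hc : ∀ t, Commute (invAdd R t) ((t : ℂ) • 1 + R) := fun t =>
    ((Commute.one_right _).smul_right _).add_right
      ((Commute.refl R).cfc_real _)
  have heq : ∀ t ∈ Ioi (0 : ℝ), invAdd R t = Ring.inverse ((t : ℂ) • 1 + R) := by
    intro t ht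
    have h := invAdd_mul hR h0 (mem_Ioi.mp ht)
    exact (Ring.inverse_unit ⟨(t : ℂ) • 1 + R, invAdd R t, (hc t).eq.symm.trans h, h⟩).symm
  refine ContinuousOn.congr (fun t ht => ?_) heq
  have h := invAdd_mul hR h0 (mem_Ioi.mp ht)
  have := NormedRing.inverse_continuousAt
    ⟨(t : ℂ) • 1 + R, invAdd R t, (hc t).eq.symm.trans h, h⟩
  exact (ContinuousAt.comp (f := fun t : ℝ => ((t : ℂ) • 1 + R : 𝒜)) this
    (by fun_prop)).continuousWithinAt

theorem rpow_mul_invAdd (h0 : ∀ x ∈ spectrum ℝ R, 0 ≤ x) {s t : ℝ} (hs : 0 ≤ s) (ht : 0 < t) :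
    rpow R s * invAdd R t = cfc (fun x : ℝ => x ^ s * (t + x)⁻¹) R :=
  (cfc_mul _ _ R (Real.continuous_rpow_const hs).continuousOn (continuousOn_inv_add h0 ht)).symm

/-- Pointwise `x ^ s ≤ (t + x) ^ s` on the spectrum; this is the estimate used for `t ≤ 1`. The
companion `norm_rpow_mul_invAdd_le_inv` uses `x ≤ 1` instead and serves for `t > 1`. -/
theorem norm_rpow_mul_invAdd_le (h0 : ∀ x ∈ spectrum ℝ R, 0 ≤ x) {s t : ℝ} (hs : 0 ≤ s)
    (hs1 : s ≤ 1) (ht : 0 < t) : ‖rpow R s * invAdd R t‖ ≤ t ^ (s - 1) := by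
  rw [rpow_mul_invAdd h0 hs ht]
  refine norm_cfc_le (by positivity) fun x hx => ?_
  have hx0 := h0 x hx
  have hpos : 0 < t + x := by positivity
  rw [Real.norm_of_nonneg (by positivity)]
  calc x ^ s * (t + x)⁻¹ ≤ (t + x) ^ s * (t + x)⁻¹ := by gcongr; linarith
    _ = (t + x) ^ (s - 1) := by rw [Real.rpow_sub_one hpos.ne', div_eq_mul_inv]
    _ ≤ t ^ (s - 1) := Real.rpow_le_rpow_of_nonpos ht (by linarith) (by linarith)

theorem norm_rpow_mul_invAdd_le_inv (h0 : ∀ x ∈ spectrum ℝ R, 0 ≤ x)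
    (h1 : ∀ x ∈ spectrum ℝ R, x ≤ 1) {s t : ℝ} (hs : 0 ≤ s) (ht : 0 < t) :
    ‖rpow R s * invAdd R t‖ ≤ t⁻¹ := by
  rw [rpow_mul_invAdd h0 hs ht]
  refine norm_cfc_le (by positivity) fun x hx => ?_
  have hx0 := h0 x hx
  rw [Real.norm_of_nonneg (by positivity)]
  calc x ^ s * (t + x)⁻¹ ≤ 1 * t⁻¹ := by
        gcongr
        · exact Real.rpow_le_one hx0 (h1 x hx) hs
        · linarith
    _ = t⁻¹ := one_mul _

/-- `R ^ (1/2)` is a multiple of `∫ t ^ (-1/2) R (t + R)⁻¹ dt`. -/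
theorem rpow_half_eq_integral (hR : IsSelfAdjoint R) (h0 : ∀ x ∈ spectrum ℝ R, 0 ≤ x)
    (h1 : ∀ x ∈ spectrum ℝ R, x ≤ 1) :
    ∃ c : ℝ, IntegrableOn (fun t : ℝ => t ^ (-(1 / 2) : ℝ) • (R * invAdd R t)) (Ioi 0) ∧
      c • ∫ t in Ioi (0 : ℝ), t ^ (-(1 / 2) : ℝ) • (R * invAdd R t) = rpow R (1 / 2) := by
  have hp : (1 / 2 : ℝ) ∈ Ioo (0 : ℝ) 1 := by constructor <;> norm_num
  have hf : ContinuousOn (Function.uncurry fun t x : ℝ => t ^ (-(1 / 2) : ℝ) * (x * (t + x)⁻¹))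
      (Ioi 0 ×ˢ spectrum ℝ R) := by
    refine ContinuousOn.mul ?_ (ContinuousOn.mul (by fun_prop) ?_)
    · exact ContinuousOn.rpow_const (by fun_prop) fun q hq => .inl (ne_of_gt hq.1)
    · refine ContinuousOn.inv₀ (by fun_prop) fun q hq => ?_
      have := h0 _ hq.2
      have h2 : 0 < q.1 := hq.1
      positivity
  have hb : ∀ t ∈ Ioi (0 : ℝ), ∀ x ∈ spectrum ℝ R,
      ‖t ^ (-(1 / 2) : ℝ) * (x * (t + x)⁻¹)‖ ≤ halfLineBound (1 / 2) t := by
    intro t ht x hx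
    have ht : 0 < t := ht
    have hx0 := h0 x hx
    have hx1 := h1 x hx
    rw [Real.norm_of_nonneg (by positivity), halfLineBound]
    split_ifs
    · calc t ^ (-(1 / 2) : ℝ) * (x * (t + x)⁻¹) ≤ t ^ (-(1 / 2) : ℝ) * 1 := by
            gcongr
            rw [mul_inv_le_iff₀ (by positivity)]
            linarith
        _ = t ^ (1 / 2 - 1 : ℝ) := by norm_num
    · calc t ^ (-(1 / 2) : ℝ) * (x * (t + x)⁻¹) ≤ t ^ (-(1 / 2) : ℝ) * (1 * t⁻¹) := by
            gcongr
            linarith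
        _ = t ^ (-(3 / 2) : ℝ) := by
            rw [one_mul, ← div_eq_mul_inv, ← Real.rpow_sub_one ht.ne']
            norm_num
  have hbound : ∀ᵐ t ∂volume.restrict (Ioi (0 : ℝ)), ∀ x ∈ spectrum ℝ R,
      ‖t ^ (-(1 / 2) : ℝ) * (x * (t + x)⁻¹)‖ ≤ halfLineBound (1 / 2) t :=
    ae_restrict_of_forall_mem measurableSet_Ioi hb
  have hfin : HasFiniteIntegral (halfLineBound (1 / 2)) (volume.restrict (Ioi (0 : ℝ))) :=
    (integrableOn_halfLineBound (by norm_num)).2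
  have key : EqOn (fun t : ℝ => cfc (fun x : ℝ => t ^ (-(1 / 2) : ℝ) * (x * (t + x)⁻¹)) R)
      (fun t : ℝ => t ^ (-(1 / 2) : ℝ) • (R * invAdd R t)) (Ioi 0) := by
    intro t ht
    have hc := continuousOn_inv_add h0 (mem_Ioi.mp ht)
    have h2 : R * invAdd R t = cfc (fun x : ℝ => x * (t + x)⁻¹) R := by
      rw [cfc_mul _ _ R (by fun_prop) hc, cfc_id' ℝ R, invAdd]
    change cfc _ R = t ^ (-(1 / 2) : ℝ) • (R * invAdd R t)
    rw [h2, ← cfc_smul (t ^ (-(1 / 2) : ℝ)) (fun x : ℝ => x * (t + x)⁻¹) R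
      (continuousOn_id.mul hc)]
    rfl
  have hint := integrableOn_cfc measurableSet_Ioi _ _ R hf hbound hfin
  -- The scalar integral is homogeneous of degree `1/2` in `x`, so its value at `x = 1` is the
  -- normalizing constant.
  refine ⟨(∫ t in Ioi 0, Real.rpowIntegrand₀₁ (1 / 2) t 1)⁻¹,
    hint.congr_fun key measurableSet_Ioi, ?_⟩
  rw [← setIntegral_congr_fun measurableSet_Ioi key,
    ← cfc_setIntegral measurableSet_Ioi _ _ R hf hbound hfin]
  have hcont : ContinuousOn (fun x : ℝ => ∫ t in Ioi (0 : ℝ), t ^ (-(1 / 2) : ℝ) * (x * (t + x)⁻¹))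
      (spectrum ℝ R) := by
    refine ContinuousOn.congr (f := fun x : ℝ =>
      x ^ (1 / 2 : ℝ) * ∫ t in Ioi 0, Real.rpowIntegrand₀₁ (1 / 2) t 1)
      (((Real.continuous_rpow_const (by norm_num)).mul continuous_const).continuousOn)
      fun x hx => ?_
    change ∫ t in Ioi (0 : ℝ), t ^ (-(1 / 2) : ℝ) * (x * (t + x)⁻¹) =
      x ^ (1 / 2 : ℝ) * ∫ t in Ioi 0, Real.rpowIntegrand₀₁ (1 / 2) t 1
    rw [← Real.integral_rpowIntegrand₀₁_eq_rpow_mul_const hp (h0 x hx)]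
    refine setIntegral_congr_fun measurableSet_Ioi fun t ht => ?_
    rw [Real.rpowIntegrand₀₁_eq_pow_div hp (mem_Ioi.mp ht).le (h0 x hx)]
    norm_num
    ring
  rw [← cfc_smul _ _ R hcont, rpow]
  refine cfc_congr fun x hx => ?_
  rw [Real.rpow_eq_const_mul_integral hp (h0 x hx), smul_eq_mul]
  congr 1
  refine setIntegral_congr_fun measurableSet_Ioi fun t ht => ?_
  rw [Real.rpowIntegrand₀₁_eq_pow_div hp (mem_Ioi.mp ht).le (h0 x hx)]
  norm_num
  ring

end Abstract

/-! ### A norm-convergent integral for the graded commutator -/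

section Commutator

variable {𝒜 : Type*} [CStarAlgebra 𝒜] {R F a a' N N' T T' : 𝒜} {s : ℝ}

/-- With `S = R Q` one has `D S = F H Q`, `D² S = Q - R Q` and `(1 + t) S + t D² S = 1`. Inserting
this unit to the right of `a` and to the left of `a'` turns `D S a - a' D S` into `(1 + t) S [D, a]
S - t (D S) [D, a'] (D S)`; then `[D, a] H = T R^s` and `[D, a'] H = T' R^s` are substituted. -/
theorem commutator_mul_invAdd (hR : IsSelfAdjoint R) (h0 : ∀ x ∈ spectrum ℝ R, 0 ≤ x)
    (hFR : Commute F R) (hF : F * F = 1 - R)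
    (hN : rpow R (1 / 2) * N = a * rpow R (1 / 2)) (hT : F * N = a' * F + T * rpow R s)
    (hN' : rpow R (1 / 2) * N' = a' * rpow R (1 / 2)) (hT' : F * N' = a * F + T' * rpow R s)
    {t : ℝ} (ht : 0 < t) :
    F * rpow R (1 / 2) * invAdd R t * a - a' * (F * rpow R (1 / 2) * invAdd R t) =
      (1 + t : ℂ) • (R * invAdd R t * T * (rpow R s * rpow R (1 / 2) * invAdd R t)) -
      (t : ℂ) • (F * rpow R (1 / 2) * invAdd R t * T' * (F * rpow R s * invAdd R t)) := by
  set H := rpow R (1 / 2) with hH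
  set G := rpow R s
  set Q := invAdd R t with hQ
  have hHH : H * H = R := by
    rw [hH, ← rpow_add h0 (by norm_num) (by norm_num)]
    norm_num
    exact rpow_one hR
  have hFH : F * H = H * F := hFR.symm.cfc_real _ |>.eq.symm
  have hFG : F * G = G * F := hFR.symm.cfc_real _ |>.eq.symm
  have hFQ : F * Q = Q * F := hFR.symm.cfc_real _ |>.eq.symm
  have hHQ : H * Q = Q * H := cfc_commute_cfc _ _ R
  have hQ2 : (t : ℂ) • Q + R * Q = 1 := smul_invAdd_add hR h0 ht
  -- This is `S [D, a] S = (D S) a S - S a' (D S)`.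
  have e1 : R * Q * T * (G * H * Q) = F * H * Q * a * (R * Q) - R * Q * a' * (F * H * Q) := by
    have h1 : T * G = F * N - a' * F := by rw [hT]; abel
    have h2 : R * Q * F = F * H * Q * H := by
      rw [← hHH]
      simp only [mul_assoc]
      rw [← hHQ, ← hFQ, ← mul_assoc H F Q, ← hFH, ← mul_assoc H (F * H) Q, ← mul_assoc H F H,
        ← hFH]
      simp only [mul_assoc]
    calc R * Q * T * (G * H * Q) = R * Q * (T * G) * H * Q := by simp only [mul_assoc]
      _ = R * Q * F * N * H * Q - R * Q * a' * (F * H * Q) := by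
        rw [h1]; simp only [mul_sub, sub_mul, mul_assoc]
      _ = F * H * Q * (H * N) * H * Q - R * Q * a' * (F * H * Q) := by
        rw [h2]; simp only [mul_assoc]
      _ = _ := by
        have h3 : F * H * Q * a * (R * Q) = F * H * Q * a * (H * H * Q) := by rw [hHH]
        rw [hN, h3]; simp only [mul_assoc]
  -- This is `(D S) [D, a'] (D S) = (D² S) a' (D S) - (D S) a (D² S)`, with `[D, a'] = D a' - a D`.
  have e2 : F * H * Q * T' * (F * G * Q) =
      (Q - R * Q) * a' * (F * H * Q) - F * H * Q * a * (Q - R * Q) := by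
    have h1 : T' * G = F * N' - a * F := by rw [hT']; abel
    have h2 : F * H * Q * F = (Q - R * Q) * H := by
      have : Q - R * Q = F * F * Q := by rw [hF, sub_mul, one_mul]
      rw [this]
      simp only [mul_assoc]
      rw [← hFQ, ← hHQ, ← mul_assoc H F Q, ← hFH]
      simp only [mul_assoc]
    have h3 : F * F * Q = Q - R * Q := by rw [hF, sub_mul, one_mul]
    calc F * H * Q * T' * (F * G * Q) = F * H * Q * (T' * G) * F * Q := by
          rw [hFG]; simp only [mul_assoc]
      _ = F * H * Q * F * N' * F * Q - F * H * Q * a * (F * F * Q) := by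
        rw [h1]; simp only [mul_sub, sub_mul, mul_assoc]
      _ = (Q - R * Q) * (H * N') * F * Q - F * H * Q * a * (Q - R * Q) := by
        rw [h2, h3]; simp only [mul_assoc]
      _ = _ := by
        rw [hN', hFH]; simp only [mul_assoc]
  rw [e1, e2]
  have h5 : (1 + t : ℂ) • (R * Q) + (t : ℂ) • (Q - R * Q) = 1 := by
    rw [add_smul, one_smul, smul_sub, ← hQ2]; abel
  calc F * H * Q * a - a' * (F * H * Q)
      = F * H * Q * a * ((1 + t : ℂ) • (R * Q) + (t : ℂ) • (Q - R * Q)) -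
        ((1 + t : ℂ) • (R * Q) + (t : ℂ) • (Q - R * Q)) * a' * (F * H * Q) := by
        rw [h5, mul_one, one_mul]
    _ = _ := by
      simp only [mul_add, add_mul, mul_smul_comm, smul_mul_assoc]
      rw [smul_sub, smul_sub]
      abel

/-- A graded commutator with `F = D (1 + D²)^(-1/2)` is compact from the left. Here `R` stands for
`(1 + D²)⁻¹`, and `hN`, `hT` say that `a` preserves the domain of `D`, with
`(D a - a' D) (1 + D²)^(-1/2) = T R ^ s`. -/
theorem mul_commutator_mem (hR : IsSelfAdjoint R) (h0 : ∀ x ∈ spectrum ℝ R, 0 ≤ x)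
    (h1 : ∀ x ∈ spectrum ℝ R, x ≤ 1) (hcancel : ∀ x : 𝒜, x * rpow R (1 / 2) = 0 → x = 0)
    (hFR : Commute F R) (hF : F * F = 1 - R) (hs : 0 < s) (hs1 : s ≤ 1 / 2)
    (hN : rpow R (1 / 2) * N = a * rpow R (1 / 2)) (hT : F * N = a' * F + T * rpow R s)
    (hN' : rpow R (1 / 2) * N' = a' * rpow R (1 / 2)) (hT' : F * N' = a * F + T' * rpow R s)
    (K : Submodule ℂ 𝒜) (hK : IsClosed (K : Set 𝒜)) (hKmul : ∀ x ∈ K, ∀ y, x * y ∈ K)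
    {b : 𝒜} (hb : b * rpow R (1 / 2) ∈ K) : b * (F * a - a' * F) ∈ K := by
  obtain ⟨c, hint, hc⟩ := rpow_half_eq_integral hR h0 h1
  set H := rpow R (1 / 2) with hH
  have hHH : H * H = R := by
    rw [hH, ← rpow_add h0 (by norm_num) (by norm_num)]
    norm_num
    exact rpow_one hR
  have hFH : F * H = H * F := hFR.symm.cfc_real _ |>.eq.symm
  have hHQ : ∀ t, H * invAdd R t = invAdd R t * H := fun t => cfc_commute_cfc _ _ R
  let J : ℝ → 𝒜 := fun t => t ^ (-(1 / 2) : ℝ) •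
    (F * H * invAdd R t * a - a' * (F * H * invAdd R t))
  have hJ : ∀ t ∈ Ioi (0 : ℝ), J t = t ^ (-(1 / 2) : ℝ) •
      ((1 + t : ℂ) • (R * invAdd R t * T * (rpow R s * H * invAdd R t)) -
      (t : ℂ) • (F * H * invAdd R t * T' * (F * rpow R s * invAdd R t))) := fun t ht => by
    simp only [J]
    rw [commutator_mul_invAdd hR h0 hFR hF hN hT hN' hT' (mem_Ioi.mp ht)]
  have hJcont : ContinuousOn J (Ioi 0) := by
    have hQ := continuousOn_invAdd hR h0
    have hr : ContinuousOn (fun t : ℝ => t ^ (-(1 / 2) : ℝ)) (Ioi 0) :=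
      ContinuousOn.rpow_const (by fun_prop) fun q hq => .inl (ne_of_gt hq)
    exact hr.smul (((continuousOn_const.mul hQ).mul continuousOn_const).sub
      (continuousOn_const.mul (continuousOn_const.mul hQ)))
  -- Near `0` both terms are of order `t^(s-1)`: the first as `t^(-1/2) · 1 · t^(s-1/2)`, the second
  -- as `t^(-1/2) · t · t^(-1/2) · t^(s-1)`. Near infinity each resolvent factor contributes `t⁻¹`,
  -- which leaves `t^(-3/2)`.
  have hJnorm : ∀ t ∈ Ioi (0 : ℝ),
      ‖J t‖ ≤ halfLineBound s t * (2 * ‖T‖ + ‖F‖ * ‖T'‖ * ‖F‖) := by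
    intro t ht
    have ht : 0 < t := ht
    rw [hJ t ht]
    have nR : R = rpow R 1 := (rpow_one hR).symm
    have nG : rpow R s * H = rpow R (s + 1 / 2) := (rpow_add h0 hs.le (by norm_num)).symm
    have hn1 : ‖(1 + t : ℂ)‖ = 1 + t := by
      rw [← Complex.ofReal_one, ← Complex.ofReal_add, Complex.norm_real,
        Real.norm_of_nonneg (by positivity)]
    have hn2 : ‖(t : ℂ)‖ = t := by rw [Complex.norm_real, Real.norm_of_nonneg ht.le]
    have bound : ∀ {p q r : ℝ}, ‖R * invAdd R t‖ ≤ p → ‖rpow R s * H * invAdd R t‖ ≤ q →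
        ‖H * invAdd R t‖ ≤ r → ∀ {m : ℝ}, ‖rpow R s * invAdd R t‖ ≤ m →
        ‖t ^ (-(1 / 2) : ℝ) •
          ((1 + t : ℂ) • (R * invAdd R t * T * (rpow R s * H * invAdd R t)) -
          (t : ℂ) • (F * H * invAdd R t * T' * (F * rpow R s * invAdd R t)))‖ ≤
        t ^ (-(1 / 2) : ℝ) * ((1 + t) * (p * ‖T‖ * q) + t * (‖F‖ * r * ‖T'‖ * (‖F‖ * m))) := by
      intro p q r hp hq hr m hm
      have hp0 := (norm_nonneg _).trans hp
      have hq0 := (norm_nonneg _).trans hq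
      have hr0 := (norm_nonneg _).trans hr
      have hm0 := (norm_nonneg _).trans hm
      rw [norm_smul, Real.norm_of_nonneg (by positivity)]
      gcongr
      refine (norm_sub_le _ _).trans ?_
      rw [norm_smul, norm_smul, hn1, hn2]
      gcongr
      · refine (norm_mul_le _ _).trans ?_
        gcongr
        refine (norm_mul_le _ _).trans ?_
        gcongr
      · refine (norm_mul_le _ _).trans ?_
        gcongr
        · refine (norm_mul_le _ _).trans ?_
          gcongr
          rw [mul_assoc]
          refine (norm_mul_le _ _).trans ?_
          gcongr
        · rw [mul_assoc]
          refine (norm_mul_le _ _).trans ?_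
          gcongr
    rw [halfLineBound]
    split_ifs with h
    · have b1 : ‖R * invAdd R t‖ ≤ 1 := by
        have := norm_rpow_mul_invAdd_le h0 zero_le_one le_rfl ht
        rwa [← nR, sub_self, Real.rpow_zero] at this
      have b2 : ‖rpow R s * H * invAdd R t‖ ≤ t ^ (s + 1 / 2 - 1) := by
        rw [nG]; exact norm_rpow_mul_invAdd_le h0 (by linarith) (by linarith) ht
      have b3 : ‖H * invAdd R t‖ ≤ t ^ (1 / 2 - 1 : ℝ) :=
        norm_rpow_mul_invAdd_le h0 (by norm_num) (by norm_num) ht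
      have b4 : ‖rpow R s * invAdd R t‖ ≤ t ^ (s - 1) :=
        norm_rpow_mul_invAdd_le h0 hs.le (by linarith) ht
      refine (bound b1 b2 b3 b4).trans ?_
      have e1 : t ^ (s + 1 / 2 - 1) = t ^ (s - 1) * t ^ (1 / 2 : ℝ) := by
        rw [← Real.rpow_add ht]; congr 1; ring
      have e2 : t ^ (1 / 2 - 1 : ℝ) * t = t ^ (1 / 2 : ℝ) := by
        rw [← Real.rpow_add_one ht.ne']; norm_num
      have e3 : t ^ (-(1 / 2) : ℝ) * t ^ (1 / 2 : ℝ) = 1 := by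
        rw [← Real.rpow_add ht]; norm_num
      calc _ = (t ^ (-(1 / 2) : ℝ) * t ^ (1 / 2 : ℝ)) * t ^ (s - 1) * ((1 + t) * ‖T‖) +
            t ^ (-(1 / 2) : ℝ) * (t ^ (1 / 2 - 1 : ℝ) * t) * t ^ (s - 1) *
              (‖F‖ * ‖T'‖ * ‖F‖) := by rw [e1]; ring
        _ = t ^ (s - 1) * ((1 + t) * ‖T‖ + ‖F‖ * ‖T'‖ * ‖F‖) := by rw [e2, e3]; ring
        _ ≤ _ := by gcongr; linarith
    · have b1 : ‖R * invAdd R t‖ ≤ t⁻¹ := by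
        have := norm_rpow_mul_invAdd_le_inv h0 h1 zero_le_one ht
        rwa [← nR] at this
      have b2 : ‖rpow R s * H * invAdd R t‖ ≤ t⁻¹ := by
        rw [nG]; exact norm_rpow_mul_invAdd_le_inv h0 h1 (by linarith) ht
      have b3 : ‖H * invAdd R t‖ ≤ t⁻¹ := norm_rpow_mul_invAdd_le_inv h0 h1 (by norm_num) ht
      have b4 : ‖rpow R s * invAdd R t‖ ≤ t⁻¹ := norm_rpow_mul_invAdd_le_inv h0 h1 hs.le ht
      refine (bound b1 b2 b3 b4).trans ?_
      have e1 : t ^ (-(1 / 2) : ℝ) * t⁻¹ = t ^ (-(3 / 2) : ℝ) := by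
        rw [← div_eq_mul_inv, ← Real.rpow_sub_one ht.ne']; norm_num
      have e2 : (1 + t) * t⁻¹ ≤ 2 := by
        rw [mul_inv_le_iff₀ ht]; linarith
      calc _ = t ^ (-(1 / 2) : ℝ) * t⁻¹ * ((1 + t) * t⁻¹ * ‖T‖ +
            (t * t⁻¹) * (‖F‖ * ‖T'‖ * ‖F‖)) := by ring
        _ = t ^ (-(3 / 2) : ℝ) * ((1 + t) * t⁻¹ * ‖T‖ + ‖F‖ * ‖T'‖ * ‖F‖) := by
          rw [e1, mul_inv_cancel₀ ht.ne', one_mul]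
        _ ≤ _ := by gcongr
  have hJint : IntegrableOn J (Ioi 0) :=
    Integrable.mono' ((integrableOn_halfLineBound hs).mul_const _)
      (hJcont.aestronglyMeasurable measurableSet_Ioi)
      (ae_restrict_of_forall_mem measurableSet_Ioi hJnorm)
  -- The separate pieces of `J` need not be integrable, so the integral cannot be split directly.
  -- Multiplying by `H` on the right and using `a H = H N` replaces `H Q` by `R Q` in both pieces;
  -- these are integrable, and `H` is cancelled at the end.
  have hmain : c • ∫ t in Ioi 0, J t = F * a - a' * F := by
    rw [← sub_eq_zero]
    refine hcancel _ ?_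
    rw [sub_mul, sub_eq_zero, smul_mul_assoc, ← integral_mul_const_of_integrable hJint]
    have hpt : ∀ t, J t * H = F * (t ^ (-(1 / 2) : ℝ) • (R * invAdd R t)) * N -
        a' * (F * (t ^ (-(1 / 2) : ℝ) • (R * invAdd R t))) := by
      intro t
      have : H * invAdd R t * H = R * invAdd R t := by
        rw [mul_assoc, ← hHQ, ← mul_assoc, hHH]
      simp only [J, mul_smul_comm, smul_mul_assoc, sub_mul, ← smul_sub]
      congr 2
      · rw [mul_assoc _ a H, ← hN, ← this]; simp only [mul_assoc]
      · rw [← this]; simp only [mul_assoc]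
    have hFi := hint.const_mul F
    simp_rw [hpt]
    rw [integral_sub (hFi.mul_const N) (hFi.const_mul a'),
      integral_mul_const_of_integrable hFi, integral_const_mul_of_integrable hFi,
      integral_const_mul_of_integrable hint, smul_sub, ← smul_mul_assoc, ← mul_smul_comm,
      ← mul_smul_comm, ← mul_smul_comm, hc]
    rw [mul_assoc F H N, hN, sub_mul, mul_assoc, mul_assoc]
  rw [← hmain, mul_smul_comm, ← integral_const_mul_of_integrable hJint]
  refine K.smul_of_tower_mem c (integral_mem_submodule K hK
    (ae_restrict_of_forall_mem measurableSet_Ioi fun t ht => ?_))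
  -- Every term of the integrand starts with `R` or with `F H = H F`, so a left factor `b` always
  -- meets an `H`.
  have hbR : b * R ∈ K := by rw [← hHH, ← mul_assoc]; exact hKmul _ hb _
  have hbF : b * (F * H) ∈ K := by rw [hFH, ← mul_assoc]; exact hKmul _ hb _
  rw [hJ t ht, mul_smul_comm, mul_sub, mul_smul_comm, mul_smul_comm]
  refine K.smul_of_tower_mem _ (K.sub_mem (K.smul_mem _ ?_) (K.smul_mem _ ?_))
  · simpa only [mul_assoc] using hKmul _ hbR (invAdd R t * T * (rpow R s * H * invAdd R t))
  · simpa only [mul_assoc] using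
      hKmul _ hbF (invAdd R t * T' * (F * rpow R s * invAdd R t))

end Commutator

end Analysis

open Filter Topology

/-! ## The ideal of compact operators -/

section Compact

variable {C E : Type*} [NonUnitalCStarAlgebra C] [PartialOrder C]
  [NormedAddCommGroup E] [NormedSpace ℂ E] [SMul C E] [CStarModule C E]

/-- The coefficient action is only an `SMul`, so its linearity in the coefficient is recovered from
nondegeneracy of the inner product. -/
theorem add_csmul (c d : C) (x : E) : (c + d) • x = c • x + d • x :=
  ext_inner (C := C) fun z => by simp [add_mul]

theorem complex_smul_csmul (r : ℂ) (c : C) (x : E) : (r • c) • x = r • c • x :=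
  ext_inner (C := C) fun z => by simp [smul_mul_assoc]

theorem norm_csmul_le (c : C) (x : E) : ‖c • x‖ ≤ ‖c‖ * ‖x‖ := by
  refine abs_le_of_sq_le_sq' ?_ (by positivity) |>.2
  rw [CStarModule.norm_sq_eq C, mul_pow, CStarModule.norm_sq_eq C (x := x)]
  simp only [CStarModule.inner_op_smul_left, CStarModule.inner_op_smul_right]
  calc ‖c * (inner C x x * star c)‖ ≤ ‖c‖ * (‖inner C x x‖ * ‖star c‖) :=
        (norm_mul_le _ _).trans (by gcongr; exact norm_mul_le _ _)
    _ = ‖c‖ ^ 2 * ‖inner C x x‖ := by rw [norm_star]; ring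

theorem Adj.sum_apply {ι : Type*} (s : Finset ι) (f : ι → Adj C E) (z : E) :
    (∑ i ∈ s, f i) z = ∑ i ∈ s, f i z := by
  classical
  induction s using Finset.induction_on with
  | empty => simp
  | insert i s hi ih => simp [Finset.sum_insert hi, ih]

variable [StarOrderedRing C]

variable (C) in
/-- The rank one operator `z ↦ x ⟪y, z⟫` as a bounded operator. -/
def rankOneCLM (x y : E) : E →L[ℂ] E :=
  LinearMap.mkContinuous
    { toFun := fun z => (inner C y z : C) • x
      map_add' := fun z w => by rw [CStarModule.inner_add_right, add_csmul]
      map_smul' := fun r z => by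
        rw [CStarModule.inner_smul_right_complex, complex_smul_csmul, RingHom.id_apply] }
    (‖y‖ * ‖x‖) fun z => by
      refine (norm_csmul_le (C := C) _ x).trans ?_
      calc ‖(inner C y z : C)‖ * ‖x‖ ≤ ‖y‖ * ‖z‖ * ‖x‖ := by
            gcongr; exact CStarModule.norm_inner_le E
        _ = ‖y‖ * ‖x‖ * ‖z‖ := by ring

variable (C) in
/-- The rank one operator `z ↦ x ⟪y, z⟫`. -/
def rankOne (x y : E) : Adj C E :=
  Adj.mk (rankOneCLM C x y) (rankOneCLM C y x) fun z w => by
    change inner C ((inner C y z : C) • x) w = inner C z ((inner C x w : C) • y)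
    simp

theorem rankOne_apply (x y z : E) : rankOne C x y z = (inner C y z : C) • x := rfl

theorem star_rankOne (x y : E) : star (rankOne C x y) = rankOne C y x :=
  Adj.star_eq_of_inner fun z w => by simp [rankOne_apply]

theorem rankOne_mul (T : Adj C E) (x y : E) : rankOne C x y * T = rankOne C x (star T y) :=
  Adj.ext fun z => by simp [rankOne_apply, Adj.inner_star_left]

theorem smul_rankOne (r : ℂ) (x y : E) : r • rankOne C x y = rankOne C (r • x) y :=
  Adj.ext fun z => ext_inner (C := C) fun w => by
    simp [rankOne_apply, mul_smul_comm]

variable (C E) in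
/-- The compact operators, as a closed subspace of `End*_C(E)`. -/
def compactOps : Submodule ℂ (Adj C E) :=
  (Submodule.span ℂ (Set.range fun p : E × E => rankOne C p.1 p.2)).topologicalClosure

theorem isClosed_compactOps : IsClosed (compactOps C E : Set (Adj C E)) :=
  Submodule.isClosed_topologicalClosure _

theorem isCompactOp_iff_mem (T : Adj C E) : IsCompactOp C T.toCLM ↔ T ∈ compactOps C E := by
  rw [compactOps, ← SetLike.mem_coe, Submodule.topologicalClosure_coe, Metric.mem_closure_iff]
  constructor
  · intro h η hη
    -- Halving `η` makes room for the strict inequality, since the pointwise estimates only give `≤`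
    -- for the operator norm.
    obtain ⟨n, x, y, hxy⟩ := h (η / 2) (by positivity)
    refine ⟨∑ i, rankOne C (x i) (y i), Submodule.sum_mem _ fun i _ =>
      Submodule.subset_span ⟨(x i, y i), rfl⟩, ?_⟩
    rw [dist_eq_norm, Adj.norm_def]
    refine (ContinuousLinearMap.opNorm_le_bound _ (by positivity) fun z => ?_).trans_lt
      (half_lt_self hη)
    have := hxy z
    rw [Adj.toCLM_apply] at this ⊢
    rw [Adj.sub_apply, Adj.sum_apply]
    exact this
  · intro h η hη
    obtain ⟨S, hS, hd⟩ := h η hη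
    obtain ⟨n, f, g, rfl⟩ := Submodule.mem_span_set'.mp hS
    choose p hp using fun i => (g i).2
    refine ⟨n, fun i => f i • (p i).1, fun i => (p i).2, fun z => ?_⟩
    have hsum : ∑ i, (inner C (p i).2 z : C) • (f i • (p i).1) =
        (∑ i, f i • (g i : Adj C E)) z := by
      rw [Adj.sum_apply]
      refine Finset.sum_congr rfl fun i _ => ?_
      rw [← hp i, smul_rankOne, rankOne_apply]
    rw [hsum, Adj.toCLM_apply, ← Adj.sub_apply]
    refine (Adj.le_norm _ z).trans ?_
    rw [dist_eq_norm] at hd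
    gcongr

/-- Additivity suffices because scalars are absorbed into the rank one operators; this covers the
adjoint, which is conjugate-linear. -/
theorem map_mem_compactOps {f : Adj C E →+ Adj C E} (hf : Continuous f)
    (h : ∀ x y : E, f (rankOne C x y) ∈
      Submodule.span ℂ (Set.range fun p : E × E => rankOne C p.1 p.2))
    {T : Adj C E} (hT : T ∈ compactOps C E) : f T ∈ compactOps C E := by
  rw [compactOps, ← SetLike.mem_coe, Submodule.topologicalClosure_coe] at hT ⊢
  refine map_mem_closure hf hT fun S hS => ?_
  obtain ⟨n, c, g, rfl⟩ := Submodule.mem_span_set'.mp hS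
  choose p hp using fun i => (g i).2
  rw [map_sum]
  refine Submodule.sum_mem _ fun i _ => ?_
  rw [← hp i, smul_rankOne]
  exact h _ _

theorem rankOne_mem_span (x y : E) :
    rankOne C x y ∈ Submodule.span ℂ (Set.range fun p : E × E => rankOne C p.1 p.2) :=
  Submodule.subset_span ⟨(x, y), rfl⟩

theorem compactOps_mul_right {T : Adj C E} (hT : T ∈ compactOps C E) (S : Adj C E) :
    T * S ∈ compactOps C E :=
  map_mem_compactOps (f := AddMonoidHom.mulRight S) (continuous_mul_const S)
    (fun x y => by
      change rankOne C x y * S ∈ _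
      rw [rankOne_mul]
      exact rankOne_mem_span _ _) hT

theorem star_mem_compactOps {T : Adj C E} (hT : T ∈ compactOps C E) :
    star T ∈ compactOps C E :=
  map_mem_compactOps (f := (starAddEquiv : Adj C E ≃+ Adj C E).toAddMonoidHom)
    (continuous_star (R := Adj C E))
    (fun x y => by
      change star (rankOne C x y) ∈ _
      rw [star_rankOne]
      exact rankOne_mem_span _ _) hT

end Compact

/-! ## The bounded transform of a selfadjoint regular operator -/

section Transform

variable {C E : Type*} [NonUnitalCStarAlgebra C] [PartialOrder C]
  [NormedAddCommGroup E] [NormedSpace ℂ E] [SMul C E] [CStarModule C E]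

namespace RegularSelfAdjoint

variable (D : RegularSelfAdjoint C E)

theorem mem_graph {x y : E} :
    (x, y) ∈ D.op.graph ↔ ∃ h : x ∈ D.op.domain, D.op ⟨x, h⟩ = y := by
  rw [LinearPMap.mem_graph_iff]
  constructor
  · rintro ⟨⟨z, hz⟩, h1, h2⟩
    dsimp only at h1 h2
    subst h1
    exact ⟨hz, h2⟩
  · rintro ⟨h, rfl⟩
    exact ⟨⟨x, h⟩, rfl, rfl⟩

variable {D} in
theorem graph_unique {x y y' : E} (h : (x, y) ∈ D.op.graph) (h' : (x, y') ∈ D.op.graph) :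
    y = y' := by
  rw [mem_graph] at h h'
  obtain ⟨_, rfl⟩ := h
  obtain ⟨_, rfl⟩ := h'
  rfl

variable {D} in
theorem graph_symm {x x' y y' : E} (h : (x, x') ∈ D.op.graph) (h' : (y, y') ∈ D.op.graph) :
    inner C x' y = inner C x y' := by
  rw [mem_graph] at h h'
  obtain ⟨_, rfl⟩ := h
  obtain ⟨_, rfl⟩ := h'
  exact D.inner_symm ⟨x, _⟩ ⟨y, _⟩

variable [StarOrderedRing C] [CompleteSpace E]

variable {D} in
theorem resolvent_add {x y z : E} (h : (x, y) ∈ D.op.graph) (h' : (y, z) ∈ D.op.graph) :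
    D.resolvent (x + z) = x := by
  rw [mem_graph] at h h'
  obtain ⟨h1, rfl⟩ := h
  obtain ⟨h2, rfl⟩ := h'
  exact D.resolventFun_eq (x := ⟨x, h1⟩) (hx := h2) rfl

/-- The operator is `D R`. It is symmetric because `y = R y + D (D R y)`, and symmetry of `D` can be
applied to each summand. -/
theorem exists_opResolvent : ∃ B : Adj C E, star B = B ∧ ∀ z,
    (D.resolvent z, B z) ∈ D.op.graph ∧ (B z, z - D.resolvent z) ∈ D.op.graph := by
  have key : ∀ z, ∃ w, ((D.resolvent z, w) ∈ D.op.graph ∧ (w, z - D.resolvent z) ∈ D.op.graph) ∧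
      ‖w‖ ≤ ‖z‖ := by
    intro z
    obtain ⟨h1, h2, h3⟩ := D.resolvent_spec z
    refine ⟨_, ⟨(D.mem_graph).mpr ⟨h1, rfl⟩, (D.mem_graph).mpr ⟨h2, ?_⟩⟩, ?_⟩
    · exact eq_sub_of_add_eq' h3
    · have := (D.norm_bounds ⟨_, h1⟩ h2).2
      rwa [h3] at this
  choose w hw hn using key
  let B : E →L[ℂ] E := LinearMap.mkContinuous
    { toFun := w
      map_add' := fun x y => graph_unique (D := D) (hw (x + y)).1 (by
        rw [map_add]; exact add_mem (hw x).1 (hw y).1)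
      map_smul' := fun r x => graph_unique (D := D) (hw (r • x)).1 (by
        rw [_root_.map_smul]; exact Submodule.smul_mem _ r (hw x).1) } 1 (by simpa using hn)
  have hB : ∀ x y, inner C (B x) y = inner C x (B y) := by
    intro x y
    have e1 := graph_symm (hw x).1 (hw y).1
    have e2 := graph_symm (hw x).2 (hw y).2
    calc inner C (w x) y = inner C (w x) (D.resolvent y) + inner C (w x) (y - D.resolvent y) := by
          rw [← CStarModule.inner_add_right, add_sub_cancel]
      _ = inner C x (w y) := by
          rw [e1, ← e2, ← CStarModule.inner_add_left, add_sub_cancel]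
  exact ⟨Adj.mk B B hB, Adj.star_eq_of_inner hB, hw⟩

/-- The bounded operator `D (1 + D²)⁻¹`. -/
def opResolvent : Adj C E := D.exists_opResolvent.choose

theorem star_opResolvent : star D.opResolvent = D.opResolvent :=
  D.exists_opResolvent.choose_spec.1

theorem resolvent_graph (z : E) : (D.resolvent z, D.opResolvent z) ∈ D.op.graph :=
  (D.exists_opResolvent.choose_spec.2 z).1

theorem opResolvent_graph (z : E) : (D.opResolvent z, z - D.resolvent z) ∈ D.op.graph :=
  (D.exists_opResolvent.choose_spec.2 z).2

variable {D} in
-- The resolvent commutes with `D` on its domain: `D` maps `D R x` to `x - R x` and this to `y - D R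
-- x`, so `(1 + D²) D R x = y`.
theorem resolvent_eq_opResolvent {x y : E} (h : (x, y) ∈ D.op.graph) :
    D.resolvent y = D.opResolvent x := by
  have h1 : (x - D.resolvent x, y - D.opResolvent x) ∈ D.op.graph :=
    sub_mem h (D.resolvent_graph x)
  have := resolvent_add (D.opResolvent_graph x) h1
  rwa [add_sub_cancel] at this

theorem opResolvent_mul_self :
    D.opResolvent * D.opResolvent = D.resolvent - D.resolvent * D.resolvent :=
  Adj.ext fun z => by
    rw [Adj.mul_apply, ← resolvent_eq_opResolvent (D.opResolvent_graph z), map_sub]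
    rfl

theorem opResolvent_mul_resolvent :
    D.opResolvent * D.resolvent = D.resolvent * D.opResolvent :=
  Adj.ext fun z => (resolvent_eq_opResolvent (D.resolvent_graph z)).symm

theorem inner_resolvent_self (z : E) : inner C z (D.resolvent z) =
    inner C (D.resolvent z) (D.resolvent z) + inner C (D.opResolvent z) (D.opResolvent z) := by
  rw [Adj.inner_left, Adj.inner_left, D.isSelfAdjoint_resolvent.star_eq, D.star_opResolvent,
    ← CStarModule.inner_add_right, ← Adj.mul_apply, ← Adj.mul_apply, ← Adj.add_apply,
    D.opResolvent_mul_self, add_sub_cancel]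

theorem norm_resolvent_le : ‖D.resolvent‖ ≤ 1 :=
  ContinuousLinearMap.opNorm_le_bound _ zero_le_one fun z => by
    obtain ⟨h1, h2, h3⟩ := D.resolvent_spec z
    have := (D.norm_bounds ⟨_, h1⟩ h2).1
    rw [h3] at this
    rwa [one_mul]

/-- Positivity comes from `R = R* R + (D R)* (D R)`. -/
theorem spectrum_nonneg : ∀ x ∈ spectrum ℝ D.resolvent, 0 ≤ x := by
  let _ := CStarAlgebra.spectralOrder (Adj C E)
  have := CStarAlgebra.spectralOrderedRing (Adj C E)
  have h : D.resolvent = star D.resolvent * D.resolvent + star D.opResolvent * D.opResolvent := by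
    rw [D.isSelfAdjoint_resolvent.star_eq, D.star_opResolvent, D.opResolvent_mul_self,
      add_sub_cancel]
  have h0 : 0 ≤ D.resolvent := by
    rw [h]
    exact add_nonneg (star_mul_self_nonneg _) (star_mul_self_nonneg _)
  exact fun x hx => spectrum_nonneg_of_nonneg h0 hx

theorem spectrum_le_one : ∀ x ∈ spectrum ℝ D.resolvent, x ≤ 1 := by
  intro x hx
  have h1 := spectrum.norm_le_norm_mul_of_mem hx
  have h2 : ‖(1 : Adj C E)‖ ≤ 1 := ContinuousLinearMap.norm_id_le
  calc x ≤ ‖x‖ := le_abs_self x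
    _ ≤ ‖D.resolvent‖ * ‖(1 : Adj C E)‖ := h1
    _ ≤ 1 * 1 := by gcongr; exact D.norm_resolvent_le
    _ = 1 := one_mul 1

theorem bddPow_add {s r : ℝ} (hs : 0 ≤ s) (hr : 0 ≤ r) :
    D.bddPow (s + r) = D.bddPow s * D.bddPow r :=
  rpow_add D.spectrum_nonneg hs hr

theorem bddPow_half_mul_self : D.bddPow (1 / 2) * D.bddPow (1 / 2) = D.resolvent := by
  rw [← D.bddPow_add (by norm_num) (by norm_num), add_halves]
  exact rpow_one D.isSelfAdjoint_resolvent

theorem star_bddPow (s : ℝ) : star (D.bddPow s) = D.bddPow s :=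
  (isSelfAdjoint_rpow (R := D.resolvent) s).star_eq

/-- It suffices to approximate `x ∈ Dom D`. With `u = (t + R)⁻¹ x` the error of `R u` is `t u`, and
pairing `u` with `x` bounds `t ‖u‖²` by `(‖x‖ + ‖D x‖)²`, so the error is `O(√t)`. -/
theorem denseRange_resolvent : DenseRange D.resolvent := by
  have hsub : (D.op.domain : Set E) ⊆ closure (Set.range D.resolvent) := by
    intro x hx
    set y := D.op ⟨x, hx⟩
    have hxy : (x, y) ∈ D.op.graph := D.mem_graph.mpr ⟨hx, rfl⟩
    rw [Metric.mem_closure_iff]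
    intro η hη
    set M := ‖x‖ + ‖y‖
    obtain ⟨t, ht, htM⟩ : ∃ t : ℝ, 0 < t ∧ t * M ^ 2 < η ^ 2 := by
      refine ⟨η ^ 2 / (M ^ 2 + 1), by positivity, ?_⟩
      rw [div_mul_eq_mul_div, div_lt_iff₀ (by positivity)]
      have : 0 < η ^ 2 := by positivity
      linarith
    set u := invAdd D.resolvent t x
    have hu : (t : ℂ) • u + D.resolvent u = x := by
      have := DFunLike.congr_fun
        (smul_invAdd_add D.isSelfAdjoint_resolvent D.spectrum_nonneg ht) x
      rw [Adj.add_apply, Adj.smul_apply, Adj.mul_apply, Adj.one_apply] at this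
      exact this
    set v := D.resolvent u
    set b := D.opResolvent u
    have e1 : inner C u x = inner C v x + inner C b y := by
      rw [← graph_symm (D.opResolvent_graph u) hxy, ← CStarModule.inner_add_left]
      congr 1
      abel
    have e2 : inner C u x = (t : ℂ) • inner C u u + (inner C v v + inner C b b) := by
      conv_lhs => rw [← hu]
      rw [CStarModule.inner_add_right, CStarModule.inner_smul_right_complex,
        D.inner_resolvent_self]
    have p1 : (0 : C) ≤ inner C v v := CStarModule.inner_self_nonneg
    have p2 : (0 : C) ≤ inner C b b := CStarModule.inner_self_nonneg
    have p3 : (0 : C) ≤ (t : ℂ) • inner C u u := by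
      rw [Complex.coe_smul]
      exact smul_nonneg ht.le CStarModule.inner_self_nonneg
    set S := ‖(inner C u x : C)‖
    have n1 : ‖v‖ ^ 2 ≤ S := by
      rw [CStarModule.norm_sq_eq C]
      refine CStarAlgebra.norm_le_norm_of_nonneg_of_le p1 ?_
      rw [e2]
      exact (le_add_of_nonneg_right p2).trans (le_add_of_nonneg_left p3)
    have n2 : ‖b‖ ^ 2 ≤ S := by
      rw [CStarModule.norm_sq_eq C]
      refine CStarAlgebra.norm_le_norm_of_nonneg_of_le p2 ?_
      rw [e2]
      exact (le_add_of_nonneg_left p1).trans (le_add_of_nonneg_left p3)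
    have n3 : t * ‖u‖ ^ 2 ≤ S := by
      have : t * ‖u‖ ^ 2 = ‖(t : ℂ) • (inner C u u : C)‖ := by
        rw [norm_smul, CStarModule.norm_sq_eq C, Complex.norm_real, Real.norm_of_nonneg ht.le]
      rw [this]
      refine CStarAlgebra.norm_le_norm_of_nonneg_of_le p3 ?_
      rw [e2]
      exact le_add_of_nonneg_right (add_nonneg p1 p2)
    have n4 : S ≤ ‖v‖ * ‖x‖ + ‖b‖ * ‖y‖ := by
      calc S ≤ ‖(inner C v x : C)‖ + ‖(inner C b y : C)‖ := by
            simp only [S]; rw [e1]; exact norm_add_le _ _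
        _ ≤ _ := add_le_add (CStarModule.norm_inner_le E) (CStarModule.norm_inner_le E)
    -- By `n1`, `n2` and `n4`, `S ≤ √S · M`, hence `√S ≤ M`.
    have n5 : S ≤ M ^ 2 := by
      have hS : 0 ≤ S := norm_nonneg _
      have s1 : ‖v‖ ≤ √S := Real.le_sqrt_of_sq_le n1
      have s2 : ‖b‖ ≤ √S := Real.le_sqrt_of_sq_le n2
      have s3 : √S * √S ≤ √S * M := by
        rw [Real.mul_self_sqrt hS]
        refine n4.trans ?_
        rw [mul_add]
        gcongr
      have s4 : √S ≤ M := by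
        by_contra! h
        have : 0 < √S := (by positivity : 0 ≤ M).trans_lt h
        nlinarith
      calc S = √S ^ 2 := (Real.sq_sqrt hS).symm
        _ ≤ M ^ 2 := by gcongr
    refine ⟨v, ⟨u, rfl⟩, ?_⟩
    have hd : dist x v = t * ‖u‖ := by
      rw [dist_eq_norm, ← hu, add_sub_cancel_right, norm_smul, Complex.norm_real,
        Real.norm_of_nonneg ht.le]
    rw [hd]
    refine abs_lt_of_sq_lt_sq' ?_ hη.le |>.2
    calc (t * ‖u‖) ^ 2 = t * (t * ‖u‖ ^ 2) := by ring
      _ ≤ t * M ^ 2 := by gcongr; exact n3.trans n5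
      _ < η ^ 2 := htM
  exact dense_closure.mp (D.dense_domain.mono hsub)

theorem denseRange_bddPow_half : DenseRange (D.bddPow (1 / 2)) := by
  refine Dense.mono ?_ D.denseRange_resolvent
  rintro _ ⟨z, rfl⟩
  exact ⟨D.bddPow (1 / 2) z, by rw [← Adj.mul_apply, D.bddPow_half_mul_self]⟩

/-- Since `H` has dense range it can be cancelled on the right; identities involving `F` are proved
by reducing them in this way to identities between `R` and `D R`. -/
theorem eq_zero_of_mul_bddPow_half {X : Adj C E} (h : X * D.bddPow (1 / 2) = 0) : X = 0 := by
  have : (X : E → E) = (0 : Adj C E) :=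
    D.denseRange_bddPow_half.equalizer (map_continuous X) (map_continuous (0 : Adj C E))
      (funext fun z => DFunLike.congr_fun h z)
  exact DFunLike.coe_injective this

theorem opResolvent_mul_bddPow (s : ℝ) :
    D.opResolvent * D.bddPow s = D.bddPow s * D.opResolvent :=
  (Commute.cfc_real (show Commute D.resolvent D.opResolvent from
    D.opResolvent_mul_resolvent.symm) _).eq.symm

theorem resolvent_mul_bddPow (s : ℝ) :
    D.resolvent * D.bddPow s = D.bddPow s * D.resolvent :=
  (Commute.cfc_real (Commute.refl D.resolvent) _).eq.symm

theorem norm_opResolvent_le (y : E) : ‖D.opResolvent y‖ ≤ ‖D.bddPow (1 / 2) y‖ := by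
  refine abs_le_of_sq_le_sq' ?_ (norm_nonneg _) |>.2
  rw [CStarModule.norm_sq_eq C, CStarModule.norm_sq_eq C]
  refine CStarAlgebra.norm_le_norm_of_nonneg_of_le CStarModule.inner_self_nonneg ?_
  have : inner C (D.bddPow (1 / 2) y) (D.bddPow (1 / 2) y) = inner C y (D.resolvent y) := by
    rw [Adj.inner_left, D.star_bddPow, ← Adj.mul_apply, D.bddPow_half_mul_self]
  rw [this, D.inner_resolvent_self]
  exact le_add_of_nonneg_left CStarModule.inner_self_nonneg

/-- On `Ran H` the candidate is `H z ↦ D R z`, which is contractive because `⟪D R z, D R z⟫ ≤ ⟪z, R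
z⟫ = ⟪H z, H z⟫`. Density of `Ran H` and closedness of `D` carry this to every `x`. -/
theorem exists_bddPow_half_graph (x : E) :
    ∃ y, (D.bddPow (1 / 2) x, y) ∈ D.op.graph ∧ ‖y‖ ≤ ‖x‖ := by
  obtain ⟨s, hs, hlim⟩ := mem_closure_iff_seq_limit.mp (D.denseRange_bddPow_half x)
  choose z hz using hs
  have hc : CauchySeq fun n => D.opResolvent (z n) := by
    have hcs := hlim.cauchySeq
    rw [Metric.cauchySeq_iff'] at hcs ⊢
    intro ε hε
    obtain ⟨N, hN⟩ := hcs ε hε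
    refine ⟨N, fun n hn => ?_⟩
    have := hN n hn
    rw [dist_eq_norm, ← hz, ← hz, ← map_sub] at this
    rw [dist_eq_norm, ← map_sub]
    exact (D.norm_opResolvent_le _).trans_lt this
  obtain ⟨y, hy⟩ := cauchySeq_tendsto_of_complete hc
  refine ⟨y, D.mem_graph.mpr (D.closed_graph (u := fun n => D.bddPow (1 / 2) (s n)) (fun n => ?_)
    (((map_continuous (D.bddPow (1 / 2))).tendsto x).comp hlim) hy), ?_⟩
  · rw [← hz, ← Adj.mul_apply, D.bddPow_half_mul_self]
    exact D.mem_graph.mp (D.resolvent_graph _)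
  · refine le_of_tendsto_of_tendsto' hy.norm hlim.norm fun n => ?_
    rw [← hz]
    exact D.norm_opResolvent_le _

theorem exists_isBoundedTransform : ∃ F : Adj C E, D.IsBoundedTransform F := by
  choose f hf hn using D.exists_bddPow_half_graph
  let F : E →L[ℂ] E := LinearMap.mkContinuous
    { toFun := f
      map_add' := fun x y => graph_unique (D := D) (hf (x + y)) (by
        rw [map_add]; exact add_mem (hf x) (hf y))
      map_smul' := fun r x => graph_unique (D := D) (hf (r • x)) (by
        rw [_root_.map_smul]; exact Submodule.smul_mem _ r (hf x)) } 1 (by simpa using hn)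
  have hFH : ∀ x, F (D.bddPow (1 / 2) x) = D.opResolvent x := fun x => by
    refine graph_unique (D := D) (hf _) ?_
    rw [← Adj.mul_apply, D.bddPow_half_mul_self]
    exact D.resolvent_graph x
  have hF : ∀ x y, inner C (F x) y = inner C x (F y) := by
    intro x y
    refine DenseRange.induction_on₂ (p := fun x y => inner C (F x) y = inner C x (F y))
      D.denseRange_bddPow_half (isClosed_eq ?_ ?_) (fun x y => ?_) x y
    · exact (CStarModule.continuous_inner (A := C) (E := E)).comp
        (f := fun p : E × E => (F p.1, p.2)) (by fun_prop)
    · exact (CStarModule.continuous_inner (A := C) (E := E)).comp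
        (f := fun p : E × E => (p.1, F p.2)) (by fun_prop)
    · rw [hFH, hFH, Adj.inner_left, D.star_opResolvent, Adj.inner_left, D.star_bddPow,
        ← Adj.mul_apply, ← Adj.mul_apply, D.opResolvent_mul_bddPow]
  exact ⟨Adj.mk F F hF, fun x => D.mem_graph.mp (hf x)⟩

/-! ### Algebraic identities for the bounded transform -/

namespace IsBoundedTransform

variable {D} {F : Adj C E} (hF : D.IsBoundedTransform F)
include hF

theorem graph (x : E) : (D.bddPow (1 / 2) x, F x) ∈ D.op.graph := D.mem_graph.mpr (hF x)

theorem mul_bddPow_half : F * D.bddPow (1 / 2) = D.opResolvent :=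
  Adj.ext fun x => by
    refine graph_unique (D := D) (hF.graph (D.bddPow (1 / 2) x)) ?_
    rw [← Adj.mul_apply, D.bddPow_half_mul_self]
    exact D.resolvent_graph x

/-- Symmetry of `D` on the pairs `(H x, F x)` and `(H y, F y)` gives `F* H = H F`. After one more
factor `H` both `F* H²` and `F H²` equal `D R H`. -/
theorem star_eq : star F = F := by
  have h : star F * D.bddPow (1 / 2) = D.bddPow (1 / 2) * F :=
    Adj.ext fun y => ext_inner (C := C) fun x => by
      rw [Adj.mul_apply, Adj.mul_apply, ← Adj.inner_left, graph_symm (hF.graph x) (hF.graph y),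
        Adj.inner_left, D.star_bddPow]
  rw [← sub_eq_zero]
  refine D.eq_zero_of_mul_bddPow_half (D.eq_zero_of_mul_bddPow_half ?_)
  rw [sub_mul, h, sub_mul, mul_assoc, hF.mul_bddPow_half, D.opResolvent_mul_bddPow, sub_self]

theorem bddPow_half_mul : D.bddPow (1 / 2) * F = D.opResolvent := by
  rw [← star_inj, star_mul, hF.star_eq, D.star_bddPow, hF.mul_bddPow_half, D.star_opResolvent]

theorem commute_resolvent : Commute F D.resolvent := by
  rw [commute_iff_eq, ← sub_eq_zero]
  refine D.eq_zero_of_mul_bddPow_half ?_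
  rw [sub_mul, mul_assoc, D.resolvent_mul_bddPow, ← mul_assoc, mul_assoc D.resolvent,
    hF.mul_bddPow_half, D.opResolvent_mul_resolvent, sub_self]

theorem mul_self : F * F = 1 - D.resolvent := by
  rw [← sub_eq_zero]
  refine D.eq_zero_of_mul_bddPow_half (D.eq_zero_of_mul_bddPow_half ?_)
  rw [mul_assoc _ (D.bddPow _), D.bddPow_half_mul_self, sub_mul, mul_assoc,
    hF.commute_resolvent.eq, ← D.bddPow_half_mul_self, mul_assoc _ (D.bddPow _), ← mul_assoc F,
    hF.mul_bddPow_half, hF.bddPow_half_mul, D.opResolvent_mul_self, sub_mul, one_mul,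
    D.bddPow_half_mul_self, sub_self]

/-- The map `z ↦ (H z, F z)` identifies `E` with the graph of `D`, since `H² + F² = 1`; its inverse
is its adjoint `(x, y) ↦ H x + F y`. -/
theorem eq_of_mem_graph {x y : E} (h : (x, y) ∈ D.op.graph) :
    x = D.bddPow (1 / 2) (D.bddPow (1 / 2) x + F y) ∧ y = F (D.bddPow (1 / 2) x + F y) := by
  have h1 : x = D.bddPow (1 / 2) (D.bddPow (1 / 2) x + F y) := by
    rw [map_add, ← Adj.mul_apply, ← Adj.mul_apply, D.bddPow_half_mul_self, hF.bddPow_half_mul]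
    have h2 := graph_unique (D.resolvent_graph y)
      (resolvent_eq_opResolvent h ▸ D.opResolvent_graph x)
    rw [h2, add_sub_cancel]
  have h2 := hF.graph (D.bddPow (1 / 2) x + F y)
  rw [← h1] at h2
  exact ⟨h1, graph_unique h h2⟩

/-- The bounded form of the domain and commutator conditions of `IsEpsBounded`. -/
theorem exists_of_isEpsBounded {ε : ℝ} (hε : 0 < ε) {a a' : Adj C E}
    (h : D.IsEpsBounded ε a a') :
    ∃ N T : Adj C E, D.bddPow (1 / 2) * N = a * D.bddPow (1 / 2) ∧
      F * N = a' * F + T * D.bddPow (min ε 1 / 2) := by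
  obtain ⟨T, hT⟩ := h.comm_pow
  -- The commutator hypothesis is applied to the vector `R^(ε/2) z`, which `(1 + D²)^(-(1-ε)/2)`
  -- sends to `H z`.
  have key : ∀ z, (a (D.bddPow (1 / 2) z), a' (F z) + T (D.bddPow (ε / 2) z)) ∈ D.op.graph := by
    intro z
    obtain ⟨hz, e⟩ := hF z
    refine D.mem_graph.mpr ⟨h.mem_domain ⟨_, hz⟩, ?_⟩
    rw [hT _ ⟨_, hz⟩, e, add_sub_cancel]
    rw [PowGraph]
    -- For `ε ≤ 1` the relation is `R^((1-ε)/2) R^(ε/2) = H`; for `ε > 1` the power is unbounded and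
    -- the inverse relation `R^((ε-1)/2) H = R^(ε/2)` is used.
    split_ifs with hr
    · rw [← Adj.mul_apply, ← D.bddPow_add (by linarith) (by linarith)]
      ring_nf
    · rw [← Adj.mul_apply, ← D.bddPow_add (by linarith) (by norm_num)]
      ring_nf
  -- For `ε > 1` the surplus power is absorbed into `T`, which keeps the exponent at most `1/2`.
  obtain ⟨T', hT'⟩ : ∃ T' : Adj C E, T * D.bddPow (ε / 2) = T' * D.bddPow (min ε 1 / 2) := by
    rcases le_total ε 1 with h1 | h1
    · exact ⟨T, by rw [min_eq_left h1]⟩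
    · refine ⟨T * D.bddPow (ε / 2 - 1 / 2), ?_⟩
      rw [min_eq_right h1, mul_assoc, ← D.bddPow_add (by linarith) (by norm_num), sub_add_cancel]
  -- `N z` is the point representing the graph element `(a H z, D a H z)`, namely `H (a H z) + F (D
  -- a H z)`.
  refine ⟨D.bddPow (1 / 2) * a * D.bddPow (1 / 2) + F * (a' * F + T' * D.bddPow (min ε 1 / 2)), T',
    Adj.ext fun z => ?_, Adj.ext fun z => ?_⟩
  · rw [← hT']
    exact (hF.eq_of_mem_graph (key z)).1.symm
  · rw [← hT']
    exact (hF.eq_of_mem_graph (key z)).2.symm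

end IsBoundedTransform

end RegularSelfAdjoint

end Transform

/-! ## Conjugation by the grading operator -/

section GradingOperator

variable {C E : Type*} [NonUnitalCStarAlgebra C] [PartialOrder C]
  [NormedAddCommGroup E] [NormedSpace ℂ E] [SMul C E] [CStarModule C E]

namespace ModuleGrading

variable {β : Grading C} (γ : ModuleGrading β E)

theorem norm_hom_le (x : E) : ‖γ.hom x‖ ≤ ‖x‖ := by
  refine abs_le_of_sq_le_sq' ?_ (norm_nonneg _) |>.2
  rw [CStarModule.norm_sq_eq C, CStarModule.norm_sq_eq C, γ.inner_hom]
  exact NonUnitalStarAlgHom.norm_apply_le β.hom _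

/-- The grading operator as a bounded operator. -/
def homCLM : E →L[ℂ] E :=
  LinearMap.mkContinuous γ.hom 1 fun x => by simpa using γ.norm_hom_le x

@[simp] theorem homCLM_apply (x : E) : γ.homCLM x = γ.hom x := rfl

/-- The automorphism `β` appears, so the grading operator itself need not be adjointable. In a
conjugation `β` occurs twice and cancels. -/
theorem inner_hom_left (x y : E) : inner C (γ.hom x) y = β.hom (inner C x (γ.hom y)) := by
  rw [← γ.inner_hom, γ.hom_hom]

/-- Conjugation of an adjointable operator by the grading operator. -/
def conjAdj (T : Adj C E) : Adj C E :=
  Adj.mk (γ.homCLM ∘L T.toCLM ∘L γ.homCLM) (γ.homCLM ∘L (star T).toCLM ∘L γ.homCLM) fun x y => by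
    simp only [ContinuousLinearMap.comp_apply, homCLM_apply, Adj.toCLM_apply]
    rw [γ.inner_hom_left, Adj.inner_left, γ.inner_hom_left, β.hom_hom]

@[simp] theorem conjAdj_apply (T : Adj C E) (x : E) :
    γ.conjAdj T x = γ.hom (T (γ.hom x)) := rfl

/-- Conjugation by the grading operator as a `*`-homomorphism. -/
def conj : Adj C E →⋆ₐ[ℂ] Adj C E where
  toFun := γ.conjAdj
  map_one' := Adj.ext fun x => by simp [γ.hom_hom]
  map_mul' S T := Adj.ext fun x => by simp [γ.hom_hom]
  map_zero' := Adj.ext fun x => by simp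
  map_add' S T := Adj.ext fun x => by simp
  commutes' r := Adj.ext fun x => by simp [Algebra.algebraMap_eq_smul_one, γ.hom_hom]
  map_star' T := (Adj.star_eq_of_inner fun x y => by
    simp only [conjAdj_apply]
    rw [γ.inner_hom_left, Adj.inner_left, γ.inner_hom_left, β.hom_hom]).symm

@[simp] theorem conj_apply (T : Adj C E) (x : E) : γ.conj T x = γ.hom (T (γ.hom x)) := rfl

theorem hom_graph {D : RegularSelfAdjoint C E}
    (hD : ∀ x : D.op.domain, ∃ hx : γ.hom (x : E) ∈ D.op.domain,
      D.op ⟨γ.hom (x : E), hx⟩ = -γ.hom (D.op x)) {x y : E} (h : (x, y) ∈ D.op.graph) :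
    (γ.hom x, -γ.hom y) ∈ D.op.graph := by
  rw [D.mem_graph] at h ⊢
  obtain ⟨hx, rfl⟩ := h
  exact hD ⟨x, hx⟩

variable [StarOrderedRing C] [CompleteSpace E] {D : RegularSelfAdjoint C E}
  (hD : ∀ x : D.op.domain, ∃ hx : γ.hom (x : E) ∈ D.op.domain,
    D.op ⟨γ.hom (x : E), hx⟩ = -γ.hom (D.op x))
include hD

/-- The grading operator anticommutes with `D`, hence commutes with `D²` and with the inverse of `1
+ D²`. -/
theorem conj_resolvent : γ.conj D.resolvent = D.resolvent :=
  Adj.ext fun z => by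
    have h1 := γ.hom_graph hD (D.resolvent_graph (γ.hom z))
    have h2 := neg_mem (γ.hom_graph hD (D.opResolvent_graph (γ.hom z)))
    rw [Prod.neg_mk, neg_neg, map_sub, γ.hom_hom] at h2
    have h3 := RegularSelfAdjoint.resolvent_add h1 h2
    rw [add_sub_cancel] at h3
    exact h3.symm

theorem conj_bddPow {s : ℝ} (hs : 0 ≤ s) : γ.conj (D.bddPow s) = D.bddPow s := by
  have hc : Continuous γ.conj :=
    AddMonoidHomClass.continuous_of_bound γ.conj 1 fun T => by
      simpa using NonUnitalStarAlgHom.norm_apply_le γ.conj T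
  have h := StarAlgHomClass.map_cfc (S := ℂ) γ.conj (fun x : ℝ => x ^ s) D.resolvent
    (Real.continuous_rpow_const hs).continuousOn hc D.isSelfAdjoint_resolvent
    (by rw [γ.conj_resolvent hD]; exact D.isSelfAdjoint_resolvent)
  rwa [γ.conj_resolvent hD] at h

theorem hom_boundedTransform {F : Adj C E} (hF : D.IsBoundedTransform F) (x : E) :
    γ.hom (F x) = -F (γ.hom x) := by
  have h1 := γ.hom_graph hD (hF.graph x)
  have h2 := hF.graph (γ.hom x)
  have h3 : γ.hom (D.bddPow (1 / 2) x) = D.bddPow (1 / 2) (γ.hom x) := by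
    have := DFunLike.congr_fun (γ.conj_bddPow hD (s := 1 / 2) (by norm_num)) (γ.hom x)
    rwa [conj_apply, γ.hom_hom] at this
  rw [h3] at h1
  rw [← RegularSelfAdjoint.graph_unique h1 h2, neg_neg]

theorem conj_boundedTransform {F : Adj C E} (hF : D.IsBoundedTransform F) :
    γ.conj F = -F :=
  Adj.ext fun x => by
    rw [conj_apply, γ.hom_boundedTransform hD hF, γ.hom_hom, Adj.neg_apply]

end ModuleGrading

end GradingOperator

/-! ## Compactness of the graded commutators -/

section Main

/-- The functions `√|t|` and `sign(t) √|t|`, the latter written through positive and negative parts,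
vanish at `0`, so the non-unital calculus applies; their product is `t`. -/
theorem exists_mul_eq_of_isSelfAdjoint {A : Type*} [NonUnitalCStarAlgebra A] {x : A}
    (hx : IsSelfAdjoint x) : ∃ y z : A, y * z = x := by
  refine ⟨cfcₙ (fun t : ℝ => √|t|) x, cfcₙ (fun t : ℝ => √(max t 0) - √(max (-t) 0)) x, ?_⟩
  rw [← cfcₙ_mul (fun t : ℝ => √|t|) (fun t : ℝ => √(max t 0) - √(max (-t) 0)) x
    (by fun_prop) (by simp) (by fun_prop) (by simp)]
  conv_rhs => rw [← cfcₙ_id' ℝ x]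
  refine cfcₙ_congr fun t _ => ?_
  rcases le_total 0 t with h | h
  · simp [abs_of_nonneg h, h]
  · simp [abs_of_nonpos h, h]

theorem continuous_nonUnitalStarAlgHom {A B : Type*} [NonUnitalCStarAlgebra A]
    [NonUnitalCStarAlgebra B] (φ : A →⋆ₙₐ[ℂ] B) : Continuous φ :=
  AddMonoidHomClass.continuous_of_bound φ 1 fun a => by
    simpa using NonUnitalStarAlgHom.norm_apply_le φ a

variable {A C E : Type*} [NonUnitalCStarAlgebra A] [NonUnitalCStarAlgebra C] [PartialOrder C]
  [NormedAddCommGroup E] [NormedSpace ℂ E] [SMul C E] [CStarModule C E] [StarOrderedRing C]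
  [CompleteSpace E] {D : RegularSelfAdjoint C E} {F : Adj C E} {π : A →⋆ₙₐ[ℂ] Adj C E}

theorem mul_sq_sub_one_mem (hF : D.IsBoundedTransform F) {a : Adj C E}
    (h : a * D.bddPow (1 / 2) ∈ compactOps C E) : a * (F * F - 1) ∈ compactOps C E := by
  rw [hF.mul_self, sub_sub_cancel_left, mul_neg, ← D.bddPow_half_mul_self, ← mul_assoc]
  exact neg_mem (compactOps_mul_right h _)

theorem commutator_mem_compactOps (hF : D.IsBoundedTransform F) (α : Grading A)
    (hcpt : ∀ a, π a * D.bddPow (1 / 2) ∈ compactOps C E) {s : ℝ} (hs : 0 < s) (hs1 : s ≤ 1 / 2)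
    (hlip : Dense {a : A | ∃ N T N' T' : Adj C E,
      D.bddPow (1 / 2) * N = π a * D.bddPow (1 / 2) ∧
      F * N = π (α.hom a) * F + T * D.bddPow s ∧
      D.bddPow (1 / 2) * N' = π (α.hom a) * D.bddPow (1 / 2) ∧
      F * N' = π a * F + T' * D.bddPow s}) (a : A) :
    F * π a - π (α.hom a) * F ∈ compactOps C E := by
  have hπ := continuous_nonUnitalStarAlgHom π
  have hα := continuous_nonUnitalStarAlgHom α.hom
  have left : ∀ b a : A, π b * (F * π a - π (α.hom a) * F) ∈ compactOps C E := by
    intro b a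
    have hclosed : IsClosed {a : A | π b * (F * π a - π (α.hom a) * F) ∈ compactOps C E} :=
      isClosed_compactOps.preimage (continuous_const.mul ((continuous_const.mul hπ).sub
        ((hπ.comp hα).mul continuous_const)))
    refine hclosed.closure_subset_iff.mpr (fun a ha => ?_) (hlip a)
    obtain ⟨N, T, N', T', h1, h2, h3, h4⟩ := ha
    exact mul_commutator_mem D.isSelfAdjoint_resolvent D.spectrum_nonneg D.spectrum_le_one
      (fun x hx => D.eq_zero_of_mul_bddPow_half hx) hF.commute_resolvent hF.mul_self hs hs1
      h1 h2 h3 h4 _ isClosed_compactOps (fun x hx y => compactOps_mul_right hx y) (hcpt b)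
  have right : ∀ a b : A, (F * π a - π (α.hom a) * F) * π b ∈ compactOps C E := by
    intro a b
    -- Taking adjoints exchanges `a` and its graded image up to sign, hence the choice of `α.hom
    -- (star a)`.
    have h := neg_mem (star_mem_compactOps (left (star b) (α.hom (star a))))
    rw [α.hom_hom, star_mul, star_sub, star_mul, star_mul, hF.star_eq, ← map_star, ← map_star,
      ← map_star, ← map_star, star_star, star_star, ← neg_mul, neg_sub] at h
    exact h
  -- The graded Leibniz rule writes the commutator with `a b` as two terms, each of which contains a
  -- factor from `A` next to a commutator.
  have prod : ∀ a b : A, F * π (a * b) - π (α.hom (a * b)) * F ∈ compactOps C E := by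
    intro a b
    have h := add_mem (right a b) (left (α.hom a) b)
    have e : F * π (a * b) - π (α.hom (a * b)) * F = (F * π a - π (α.hom a) * F) * π b +
        π (α.hom a) * (F * π b - π (α.hom b) * F) := by
      simp only [map_mul, sub_mul, mul_sub, mul_assoc]
      abel
    rwa [e]
  obtain ⟨y, z, h1⟩ := exists_mul_eq_of_isSelfAdjoint (realPart a).2
  obtain ⟨y', z', h2⟩ := exists_mul_eq_of_isSelfAdjoint (imaginaryPart a).2
  have h := add_mem (prod y z) (Submodule.smul_mem _ Complex.I (prod y' z'))
  rw [h1, h2] at h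
  rw [← realPart_add_I_smul_imaginaryPart a]
  simp only [map_add, map_smul, mul_add, add_mul, mul_smul_comm, smul_mul_assoc]
  rw [smul_sub] at h
  convert h using 1
  abel

theorem IsOddEpsCycle.isOddKasparov {ε : ℝ} (hε : 0 < ε) (h : IsOddEpsCycle ε π D)
    (hF : D.IsBoundedTransform F) : IsOddKasparov π F where
  sq_sub_one a := (isCompactOp_iff_mem _).mpr
    (mul_sq_sub_one_mem hF ((isCompactOp_iff_mem _).mp (h.compact a)))
  sub_star a := (isCompactOp_iff_mem _).mpr (by
    rw [hF.star_eq, sub_self, mul_zero]; exact zero_mem _)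
  commutator a := (isCompactOp_iff_mem _).mpr <|
    commutator_mem_compactOps (s := min ε 1 / 2) hF (Grading.trivial A)
      (fun a => (isCompactOp_iff_mem _).mp (h.compact a)) (by positivity)
      (by have := min_le_right ε 1; linarith)
      (h.dense_lip.mono fun a ha => by
        obtain ⟨N, T, h1, h2⟩ := hF.exists_of_isEpsBounded hε ha
        exact ⟨N, T, N, T, h1, h2, h1, h2⟩) a

theorem IsEvenEpsCycle.isEvenKasparov {ε : ℝ} (hε : 0 < ε) {α : Grading A} {β : Grading C}
    {γ : ModuleGrading β E} (h : IsEvenEpsCycle ε α γ π D)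
    (hF : D.IsBoundedTransform F) : IsEvenKasparov α γ π F where
  graded := h.graded
  odd := γ.hom_boundedTransform h.odd hF
  sq_sub_one a := (isCompactOp_iff_mem _).mpr
    (mul_sq_sub_one_mem hF ((isCompactOp_iff_mem _).mp (h.compact a)))
  sub_star a := (isCompactOp_iff_mem _).mpr (by
    rw [hF.star_eq, sub_self, mul_zero]; exact zero_mem _)
  commutator a := (isCompactOp_iff_mem _).mpr <|
    commutator_mem_compactOps (s := min ε 1 / 2) hF α
      (fun a => (isCompactOp_iff_mem _).mp (h.compact a)) (by positivity)
      (by have := min_le_right ε 1; linarith)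
      (h.dense_lip.mono fun a ha => by
        obtain ⟨N, T, h1, h2⟩ := hF.exists_of_isEpsBounded hε ha
        have hπ : ∀ b, γ.conj (π b) = π (α.hom b) := fun b => Adj.ext fun x => by
          rw [γ.conj_apply, h.graded, γ.hom_hom]
        have hs : 0 ≤ min ε 1 / 2 := by positivity
        -- Conjugating the relations for `a` by the grading operator gives those for its graded
        -- image. Since `F` changes sign, the new `T'` is minus the conjugate of `T`.
        have h3 := congrArg γ.conj h1
        have h4 := congrArg γ.conj h2
        rw [map_mul, map_mul, γ.conj_bddPow h.odd (by norm_num), hπ] at h3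
        rw [map_mul, map_add, map_mul, map_mul, γ.conj_bddPow h.odd hs,
          γ.conj_boundedTransform h.odd hF, hπ, α.hom_hom] at h4
        refine ⟨N, T, γ.conj N, -γ.conj T, h1, h2, h3, ?_⟩
        rw [neg_mul, mul_neg, neg_eq_iff_eq_neg] at h4
        rw [h4, neg_mul]
        abel) a

end Main

end EpsKK

end

theorem theoremA5 {A : Type u} {B : Type v} [NonUnitalCStarAlgebra A]
    [NonUnitalCStarAlgebra B] [PartialOrder B] [StarOrderedRing B]
    {E : Type w} [NormedAddCommGroup E] [NormedSpace ℂ E] [CompleteSpace E]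
    [SMul Bᵐᵒᵖ E] [CStarModule Bᵐᵒᵖ E]
    (π : A →⋆ₙₐ[ℂ] EpsKK.Adj Bᵐᵒᵖ E) (D : EpsKK.RegularSelfAdjoint Bᵐᵒᵖ E)
    (ε : ℝ) (hε : 0 < ε) :
    (EpsKK.IsOddEpsCycle ε π D →
      ∃ F : EpsKK.Adj Bᵐᵒᵖ E, D.IsBoundedTransform F ∧
        ∃ hF : EpsKK.IsOddKasparov π F,
          ∃ c : EpsKK.KKOne.{u, v, w} A B, EpsKK.KKOne.mk ⟨E, π, F, hF⟩ = c) ∧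
    (∀ (α : EpsKK.Grading A) (β : EpsKK.Grading B) (γ : EpsKK.ModuleGrading β.op E),
      EpsKK.IsEvenEpsCycle ε α γ π D →
      ∃ F : EpsKK.Adj Bᵐᵒᵖ E, D.IsBoundedTransform F ∧
        ∃ hF : EpsKK.IsEvenKasparov α γ π F,
          ∃ c : EpsKK.KKZero.{u, v, w} α β, EpsKK.KKZero.mk ⟨E, γ, π, F, hF⟩ = c) := by
  refine ⟨fun h => ?_, fun α β γ h => ?_⟩
  · obtain ⟨F, hF⟩ := D.exists_isBoundedTransform
    exact ⟨F, hF, h.isOddKasparov hε hF, _, rfl⟩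
  · obtain ⟨F, hF⟩ := D.exists_isBoundedTransform
    exact ⟨F, hF, h.isEvenKasparov hε hF, _, rfl⟩
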